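/- Let $SO(4)$ act by conjugation on the nerve $NSO(4)$, $NSO(4)(p)=SO(4)^p$, with face operators $\varepsilon_i: SO(4)^{p+1}\to SO(4)^{p}$, $0\le i\le p+1$, given by $\varepsilon_0(h_1,\dots,h_{p+1})=(h_2,\dots,h_{p+1})$, $\varepsilon_{p+1}(h_1,\dots,h_{p+1})=(h_1,\dots,h_p)$, and $\varepsilon_i(h_1,\dots,h_{p+1})=(h_1,\dots,h_ih_{i+1},\dots,h_{p+1})$ otherwise. The equivariant simplicial de Rham complex is $$\Omega^n_{SO(4)}(NSO(4))=\bigoplus_{p+q+2r=n}\bigl(\Omega^q(SO(4)^p)\otimes S^r(\mathfrak{so}(4)^*)\bigr)^{SO(4)},$$ whose elements are regarded as invariant polynomial functions $\alpha$ on $\mathfrak{so}(4)$ with values in differential forms. Its differential is $d'+d''$, where on the components of simplicial degree $p$ $$d'=\sum_{i=0}^{p+1}(-1)^i\varepsilon_i^*,\qquad (d''\alpha)(X)=(-1)^p\,(d-i_{X_M})(\alpha(X)),$$ and $X_M$ is the vector field generated by $X$, $X_M(m)=\frac{d}{dt}\big|_{t=0}\exp(-tX)\cdot m$, that is, $X_M(h_1,\dots,h_p)=(h_1X-Xh_1,\dots,h_pX-Xh_p)$.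 Define $E_{1,3}\in\Omega^3(SO(4))$, $E_{2,2}\in\Omega^2(SO(4)\times SO(4))$ and, for $X\in\mathfrak{so}(4)$, $\mu(X)\in\Omega^1(SO(4))$ by $$E_{1,3}=\frac{1}{192\pi^2}\sum_{\tau\in\mathfrak S_4}\mathrm{sgn}(\tau)\Bigl((h^{-1}dh)_{\tau(1)\tau(2)}(h^{-1}dh)^2_{\tau(3)\tau(4)}+(h^{-1}dh)_{\tau(3)\tau(4)}(h^{-1}dh)^2_{\tau(1)\tau(2)}\Bigr),$$ $$E_{2,2}=\frac{-1}{64\pi^2}\sum_{\tau\in\mathfrak S_4}\mathrm{sgn}(\tau)\Bigl((h_1^{-1}dh_1)_{\tau(1)\tau(2)}(dh_2h_2^{-1})_{\tau(3)\tau(4)}+(h_1^{-1}dh_1)_{\tau(3)\tau(4)}(dh_2h_2^{-1})_{\tau(1)\tau(2)}\Bigr),$$ $$\mu(X)=\frac{-1}{64\pi^2}\sum_{\tau\in\mathfrak S_4}\mathrm{sgn}(\tau)\Bigl(X_{\tau(1)\tau(2)}(h^{-1}dh)_{\tau(3)\tau(4)}+X_{\tau(3)\tau(4)}(h^{-1}dh)_{\tau(1)\tau(2)}\Bigr)-\frac{1}{64\pi^2}\sum_{\tau\in\mathfrak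 S_4}\mathrm{sgn}(\tau)\Bigl(X_{\tau(1)\tau(2)}(dh\,h^{-1})_{\tau(3)\tau(4)}+X_{\tau(3)\tau(4)}(dh\,h^{-1})_{\tau(1)\tau(2)}\Bigr),$$ where products of forms are wedge products and $(h^{-1}dh)^2$ is the matrix product. Then $E_{1,3}+E_{2,2}+\mu$ is a cocycle in $\Omega^4_{SO(4)}(NSO(4))$: its components $E_{1,3}$, $E_{2,2}$, $\mu$, in tridegrees $(p,q,r)=(1,3,0)$, $(2,2,0)$, $(1,1,1)$, belong to the complex, and its total differential vanishes. -/

import Mathlib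

noncomputable section

namespace EquivariantSimplicial

attribute [local instance] LieRing.ofAssociativeRing

/-! ### The manifolds `SO(4)^p` as submanifolds of spaces of matrices -/

/-- The algebra of real `4 × 4` matrices. -/
abbrev Mat : Type := Matrix (Fin 4) (Fin 4) ℝ

/-- The group `SO(4)`. -/
abbrev SO4 : Type := Matrix.specialOrthogonalGroup (Fin 4) ℝ

/-- The Lie algebra `𝔰𝔬(4)` of skew-symmetric matrices. -/
abbrev so4 : LieSubalgebra ℝ Mat := LieAlgebra.Orthogonal.so (Fin 4) ℝ

/-- `NSO(4)(p) = SO(4) × ⋯ × SO(4)` (`p` factors), the `p`-th manifold of the nerve. -/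
abbrev N (p : ℕ) : Type := Fin p → SO4

/-- The vector space `(ℝ^{4 × 4})^p` of `p`-tuples of matrices, which contains `NSO(4)(p)` as a compact
smooth submanifold. -/
abbrev Amb (p : ℕ) : Type := Fin p → Fin 4 → Fin 4 → ℝ

/-- The `i`-th entry of a tuple of matrices. -/
def mat {p : ℕ} (v : Amb p) (i : Fin p) : Mat := Matrix.of (v i)

/-- The inclusion of `NSO(4)(p)` into the ambient vector space. -/
def toAmb {p : ℕ} (h : N p) : Amb p := fun i a b => (h i : Mat) a b

theorem mat_add {p : ℕ} (v w : Amb p) (i : Fin p) : mat (v + w) i = mat v i + mat w i := rfl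

theorem mat_smul {p : ℕ} (c : ℝ) (v : Amb p) (i : Fin p) : mat (c • v) i = c • mat v i := rfl

theorem mat_zero {p : ℕ} (i : Fin p) : mat (0 : Amb p) i = 0 := rfl

theorem mat_toAmb {p : ℕ} (h : N p) (i : Fin p) : mat (toAmb h) i = h i := rfl

theorem transpose_mul_self (g : SO4) : (g : Mat).transpose * (g : Mat) = 1 :=
  (Matrix.mem_orthogonalGroup_iff' _ _).1 (Matrix.mem_specialOrthogonalGroup_iff.1 g.2).1

theorem inv_eq_transpose (g : SO4) : (g : Mat)⁻¹ = (g : Mat).transpose :=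
  Matrix.inv_eq_left_inv (transpose_mul_self g)

theorem inv_mul_self (g : SO4) : (g : Mat)⁻¹ * (g : Mat) = 1 := by
  rw [inv_eq_transpose, transpose_mul_self]

theorem mul_inv_self (g : SO4) : (g : Mat) * (g : Mat)⁻¹ = 1 :=
  mul_eq_one_comm.1 (inv_mul_self g)

theorem inv_mul_mul_mem (g : SO4) {A : Mat} (hA : A ∈ so4) : (g : Mat)⁻¹ * A * (g : Mat) ∈ so4 := by
  rw [LieAlgebra.Orthogonal.mem_so] at hA ⊢
  simp [inv_eq_transpose, Matrix.transpose_mul, hA, Matrix.mul_assoc]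

theorem mul_mul_inv_mem (g : SO4) {A : Mat} (hA : A ∈ so4) : (g : Mat) * A * (g : Mat)⁻¹ ∈ so4 := by
  rw [LieAlgebra.Orthogonal.mem_so] at hA ⊢
  simp [inv_eq_transpose, Matrix.transpose_mul, hA, Matrix.mul_assoc]

/-- The tangent space of `NSO(4)(p)` at `h`, as a subspace of the ambient vector space:
`T_h SO(4) = h · 𝔰𝔬(4)` in each factor. -/
def tangent {p : ℕ} (h : N p) : Submodule ℝ (Amb p) where
  carrier := {v | ∀ i, (h i : Mat)⁻¹ * mat v i ∈ so4}
  add_mem' := fun ha hb i => by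
    rw [mat_add, mul_add]; exact add_mem (ha i) (hb i)
  zero_mem' := fun i => by
    rw [mat_zero, mul_zero]; exact zero_mem _
  smul_mem' := fun c v hv i => by
    rw [mat_smul, mul_smul_comm]; exact so4.smul_mem c (hv i)

/-! ### Differential forms -/

/-- Families of alternating `q`-linear forms on the tangent spaces of `NSO(4)(p)`
(no smoothness yet). -/
abbrev Form (p q : ℕ) : Type := (h : N p) → (tangent h) [⋀^Fin q]→ₗ[ℝ] ℝ

/-- Restriction (pull-back along the inclusion) of a form on the ambient vector space. -/
def restrict {p q : ℕ} (ω : Amb p → Amb p [⋀^Fin q]→L[ℝ] ℝ) : Form p q :=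
  fun h => (ω (toAmb h)).toAlternatingMap.compLinearMap (tangent h).subtype

/-- `Ω^q(NSO(4)(p))`, the space of smooth `q`-forms: as `NSO(4)(p)` is a compact submanifold, these
are the restrictions of the smooth forms of the ambient vector space. -/
def Omega (p q : ℕ) : Submodule ℝ (Form p q) where
  carrier := {α | ∃ ω : Amb p → Amb p [⋀^Fin q]→L[ℝ] ℝ, ContDiff ℝ (⊤ : ℕ∞) ω ∧ restrict ω = α}
  add_mem' := by
    rintro _ _ ⟨ω, hω, rfl⟩ ⟨η, hη, rfl⟩
    exact ⟨fun x => ω x + η x, hω.add hη, rfl⟩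
  zero_mem' := ⟨fun _ => 0, contDiff_const, rfl⟩
  smul_mem' := by
    rintro c _ ⟨ω, hω, rfl⟩
    exact ⟨fun x => c • ω x, hω.const_smul c, rfl⟩

open Classical in
/-- The exterior differential on `NSO(4)(p)`: extend the form smoothly to the ambient vector space,
differentiate there, and restrict. The result does not depend on the extension
(`extd_restrict` below). The value at a form that is not smooth is irrelevant. -/
def extd {p q : ℕ} (α : Form p q) : Form p (q + 1) :=
  if hα : α ∈ Omega p q then restrict (extDeriv hα.choose) else 0

theorem exp_mem (A : so4) : NormedSpace.exp (A : Mat) ∈ Matrix.specialOrthogonalGroup (Fin 4) ℝ := by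
  have key : ∀ B : Mat, B ∈ so4 → (NormedSpace.exp B).transpose * NormedSpace.exp B = 1 := by
    intro B hB
    rw [LieAlgebra.Orthogonal.mem_so] at hB
    rw [← Matrix.exp_transpose, hB, Matrix.exp_neg]
    exact Matrix.nonsing_inv_mul _ ((Matrix.isUnit_iff_isUnit_det _).1 (Matrix.isUnit_exp B))
  refine Matrix.mem_specialOrthogonalGroup_iff.2 ⟨(Matrix.mem_orthogonalGroup_iff' _ _).2 (key A A.2), ?_⟩
  have hB : ((1 / 2 : ℝ) • (A : Mat)) ∈ so4 := so4.smul_mem _ A.2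
  have h1 := congrArg Matrix.det (key _ hB)
  rw [Matrix.det_mul, Matrix.det_transpose, Matrix.det_one] at h1
  have h2 : (A : Mat) = (2 : ℕ) • ((1 / 2 : ℝ) • (A : Mat)) := by
    rw [← Nat.cast_smul_eq_nsmul ℝ, smul_smul]; norm_num
  rw [h2, Matrix.exp_nsmul, Matrix.det_pow, pow_two, h1]

section Exp

attribute [local instance] Matrix.linftyOpNormedRing Matrix.linftyOpNormedAlgebra

theorem contDiff_exp_entry (a b : Fin 4) :
    ContDiff ℝ (⊤ : ℕ∞) (fun B : Fin 4 → Fin 4 → ℝ =>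
      NormedSpace.exp (Matrix.of B - (Matrix.of B).transpose : Mat) a b) := by
  have h1 : ContDiff ℝ (⊤ : ℕ∞) (NormedSpace.exp : Mat → Mat) :=
    contDiff_iff_contDiffAt.2 fun x => (NormedSpace.exp_analytic (𝕂 := ℝ) x).contDiffAt
  have h2 : ContDiff ℝ (⊤ : ℕ∞) (fun B : Fin 4 → Fin 4 → ℝ =>
      (Matrix.of B - (Matrix.of B).transpose : Mat)) :=
    (LinearMap.toContinuousLinearMap
      ({ toFun := fun B => (Matrix.of B - (Matrix.of B).transpose : Mat)
         map_add' := fun B C => by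
          rw [← Matrix.of_add_of, Matrix.transpose_add]; abel
         map_smul' := fun c B => by
          rw [← Matrix.smul_of, Matrix.transpose_smul, RingHom.id_apply, smul_sub] } :
        (Fin 4 → Fin 4 → ℝ) →ₗ[ℝ] Mat)).contDiff
  exact (LinearMap.toContinuousLinearMap (Matrix.entryLinearMap ℝ ℝ a b)).contDiff.comp (h1.comp h2)

theorem hasDerivAt_exp_entry (A : Mat) (a b : Fin 4) :
    HasDerivAt (fun t : ℝ => NormedSpace.exp (t • A) a b) (A a b) 0 := by
  have h1 := hasDerivAt_exp_smul_const (𝕂 := ℝ) A (0 : ℝ)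
  rw [zero_smul, NormedSpace.exp_zero, one_mul] at h1
  exact (LinearMap.toContinuousLinearMap (Matrix.entryLinearMap ℝ ℝ a b)).hasFDerivAt.comp_hasDerivAt
    (0 : ℝ) h1

end Exp

theorem hasDerivAt_mul_entry {F G : ℝ → Mat} {F' G' : Mat} {t : ℝ}
    (hF : ∀ a b, HasDerivAt (fun s => F s a b) (F' a b) t)
    (hG : ∀ a b, HasDerivAt (fun s => G s a b) (G' a b) t) (a b : Fin 4) :
    HasDerivAt (fun s => (F s * G s) a b) ((F' * G t + F t * G') a b) t := by
  have := HasDerivAt.fun_sum (u := Finset.univ) fun c _ => (hF a c).mul (hG c b)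
  simpa only [Matrix.mul_apply, Matrix.add_apply, Finset.sum_add_distrib, Pi.mul_apply] using this

theorem hasDerivAt_toAmb_iff {p : ℕ} {γ : ℝ → N p} {t : ℝ} {v : Amb p} :
    HasDerivAt (fun s => toAmb (γ s)) v t ↔
      ∀ i a b, HasDerivAt (fun s => (γ s i : Mat) a b) (mat v i a b) t := by
  simp only [hasDerivAt_pi]
  rfl

/-- Velocities of curves in `NSO(4)(p)` are tangent vectors. -/
theorem mem_tangent_of_hasDerivAt {p : ℕ} {γ : ℝ → N p} {t : ℝ} {v : Amb p}
    (hγ : HasDerivAt (fun s => toAmb (γ s)) v t) : v ∈ tangent (γ t) := by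
  rw [hasDerivAt_toAmb_iff] at hγ
  intro i
  have h1 := hasDerivAt_mul_entry (F := fun s => (γ s i : Mat).transpose)
    (F' := (mat v i).transpose) (fun a b => hγ i b a) (hγ i)
  have h2 : (mat v i).transpose * (γ t i : Mat) + (γ t i : Mat).transpose * mat v i = 0 := by
    ext a b
    refine (h1 a b).unique ?_
    simp only [transpose_mul_self]
    exact hasDerivAt_const _ _
  rw [LieAlgebra.Orthogonal.mem_so, inv_eq_transpose, Matrix.transpose_mul,
    Matrix.transpose_transpose]
  exact eq_neg_of_add_eq_zero_left h2

/-- The parametrization `B ↦ (h_i exp(B_i - B_iᵀ))_i` of `NSO(4)(p)` around `h`. -/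
def param {p : ℕ} (h : N p) (B : Amb p) : N p :=
  fun i => h i * ⟨NormedSpace.exp (mat B i - (mat B i).transpose),
    exp_mem ⟨mat B i - (mat B i).transpose, by
      rw [LieAlgebra.Orthogonal.mem_so]; simp⟩⟩

theorem contDiff_param {p : ℕ} (h : N p) :
    ContDiff ℝ (⊤ : ℕ∞) (fun B : Amb p => toAmb (param h B)) := by
  refine contDiff_pi.2 fun i => contDiff_pi.2 fun a => contDiff_pi.2 fun b => ?_
  have : ∀ B : Amb p, toAmb (param h B) i a b = ∑ c, (h i : Mat) a c *
      NormedSpace.exp (Matrix.of (B i) - (Matrix.of (B i)).transpose : Mat) c b := fun B => rfl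
  simp only [this]
  exact ContDiff.sum fun c _ => contDiff_const.mul
    ((contDiff_exp_entry c b).comp (contDiff_apply ℝ _ i))

theorem param_zero {p : ℕ} (h : N p) : param h 0 = h := by
  funext i
  apply Subtype.ext
  simp [param, mat_zero]

theorem fderiv_param_mem {p : ℕ} (h : N p) (B w : Amb p) :
    fderiv ℝ (fun B : Amb p => toAmb (param h B)) B w ∈ tangent (param h B) := by
  have h1 : HasDerivAt (fun t : ℝ => B + t • w) w 0 := by
    simpa using ((hasDerivAt_id (0 : ℝ)).smul_const w).const_add B
  have h2 := ((contDiff_param h).differentiable (by simp) B).hasFDerivAt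
  have h3 := HasFDerivAt.comp_hasDerivAt_of_eq (0 : ℝ) h2 h1 (by simp)
  have := mem_tangent_of_hasDerivAt (γ := fun t : ℝ => param h (B + t • w)) h3
  simpa using this

theorem exists_fderiv_param_eq {p : ℕ} (h : N p) {v : Amb p} (hv : v ∈ tangent h) :
    ∃ w, fderiv ℝ (fun B : Amb p => toAmb (param h B)) 0 w = v := by
  refine ⟨fun i a b => (1 / 2 : ℝ) * ((h i : Mat)⁻¹ * mat v i) a b, ?_⟩
  set w : Amb p := fun i a b => (1 / 2 : ℝ) * ((h i : Mat)⁻¹ * mat v i) a b with hw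
  have h1 : HasDerivAt (fun t : ℝ => t • w) w 0 := by
    simpa using (hasDerivAt_id (0 : ℝ)).smul_const w
  have h2 := ((contDiff_param h).differentiable (by simp) 0).hasFDerivAt
  have h3 := HasFDerivAt.comp_hasDerivAt_of_eq (0 : ℝ) h2 h1 (by simp)
  refine h3.unique ?_
  refine hasDerivAt_toAmb_iff (γ := fun t : ℝ => param h (t • w)).2 fun i a b => ?_
  have e : ∀ t : ℝ, mat (t • w) i - (mat (t • w) i).transpose
      = t • ((h i : Mat)⁻¹ * mat v i) := by
    intro t
    have h4 := (LieAlgebra.Orthogonal.mem_so _ _ _).1 (hv i)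
    ext c d
    have h5 : ((h i : Mat)⁻¹ * mat v i) d c = -((h i : Mat)⁻¹ * mat v i) c d :=
      congrFun (congrFun h4 c) d
    have h8 : ∀ c d, mat (t • w) i c d = t * ((1 / 2 : ℝ) * ((h i : Mat)⁻¹ * mat v i) c d) :=
      fun _ _ => rfl
    rw [Matrix.sub_apply, Matrix.transpose_apply, h8, h8, h5, Matrix.smul_apply, smul_eq_mul]
    ring
  have h6 := hasDerivAt_mul_entry (F := fun _ => (h i : Mat)) (F' := 0) (t := 0)
    (fun a b => hasDerivAt_const _ _) (hasDerivAt_exp_entry ((h i : Mat)⁻¹ * mat v i)) a b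
  have h7 : (h i : Mat) * ((h i : Mat)⁻¹ * mat v i) = mat v i := by
    rw [← Matrix.mul_assoc, mul_inv_self, Matrix.one_mul]
  rw [zero_mul, zero_add, h7] at h6
  simpa only [param, Submonoid.coe_mul, e] using h6

theorem restrict_extDeriv_congr {p q : ℕ} {ω η : Amb p → Amb p [⋀^Fin q]→L[ℝ] ℝ}
    (hω : ContDiff ℝ (⊤ : ℕ∞) ω) (hη : ContDiff ℝ (⊤ : ℕ∞) η) (e : restrict ω = restrict η) :
    restrict (extDeriv ω) = restrict (extDeriv η) := by
  funext h
  ext v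
  choose w hw using fun j => exists_fderiv_param_eq h (v j).2
  have key : ∀ ζ : Amb p → Amb p [⋀^Fin q]→L[ℝ] ℝ, ContDiff ℝ (⊤ : ℕ∞) ζ →
      restrict (extDeriv ζ) h v = extDeriv (fun B => (ζ (toAmb (param h B))).compContinuousLinearMap
        (fderiv ℝ (fun B : Amb p => toAmb (param h B)) B)) 0 w := by
    intro ζ hζ
    rw [extDeriv_pullback (r := ((⊤ : ℕ∞) : WithTop ℕ∞)) (f := fun B : Amb p => toAmb (param h B))
      (hζ.differentiable (by simp) _) (contDiff_param h).contDiffAt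
      (by rw [minSmoothness_of_isRCLikeNormedField]; exact WithTop.coe_le_coe.2 le_top)]
    simp only [param_zero, ContinuousAlternatingMap.compContinuousLinearMap_apply]
    show extDeriv ζ (toAmb h) (fun j => (v j : Amb p)) = _
    congr 1
    funext j
    exact (hw j).symm
  rw [key ω hω, key η hη]
  congr 2
  funext B
  ext u
  exact congrFun (congrArg DFunLike.coe (congrFun e (param h B)))
    fun j => ⟨_, fderiv_param_mem h B (u j)⟩

theorem extd_restrict {p q : ℕ} {ω : Amb p → Amb p [⋀^Fin q]→L[ℝ] ℝ}
    (hω : ContDiff ℝ (⊤ : ℕ∞) ω) : extd (restrict ω) = restrict (extDeriv ω) := by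
  have hm : restrict ω ∈ Omega p q := ⟨ω, hω, rfl⟩
  rw [extd, dif_pos hm]
  exact restrict_extDeriv_congr hm.choose_spec.1 hω hm.choose_spec.2

/-- Pull-back of forms along a map `f : NSO(4)(m) → NSO(4)(n)` with differential `f'`. -/
def pullback {m n : ℕ} (q : ℕ) (f : N m → N n) (f' : (h : N m) → tangent h →ₗ[ℝ] tangent (f h)) :
    Form n q →ₗ[ℝ] Form m q where
  toFun α := fun h => (α (f h)).compLinearMap (f' h)
  map_add' _ _ := rfl
  map_smul' _ _ := rfl

/-! ### The simplicial structure -/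

/-- The face operator `ε_i : NSO(4)(p+1) → NSO(4)(p)`, `0 ≤ i ≤ p + 1`: omit the first entry for
`i = 0`, the last one for `i = p + 1`, and multiply the `i`-th and the `(i+1)`-st one otherwise
(the entries are numbered from `1` in this sentence and from `0` in the code). -/
def face {p : ℕ} (i : Fin (p + 2)) (h : N (p + 1)) : N p := fun j =>
  if (j : ℕ) + 1 < i then h j.castSucc
  else if (j : ℕ) + 1 = i then h j.castSucc * h j.succ
  else h j.succ

/-- The differential of `ε_i`, by the product rule (see `hasDerivAt_face`). -/
def dfaceAmb {p : ℕ} (i : Fin (p + 2)) (h : N (p + 1)) : Amb (p + 1) →ₗ[ℝ] Amb p where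
  toFun v := fun j => Matrix.of.symm (
    if (j : ℕ) + 1 < i then mat v j.castSucc
    else if (j : ℕ) + 1 = i then
      mat v j.castSucc * (h j.succ : Mat) + (h j.castSucc : Mat) * mat v j.succ
    else mat v j.succ)
  map_add' v w := by
    funext j
    rw [Pi.add_apply, ← Matrix.of.symm_apply_apply (_ + _ : Fin 4 → Fin 4 → ℝ)]
    congr 1
    rw [← Matrix.of_add_of, Equiv.apply_symm_apply, Equiv.apply_symm_apply]
    simp only [mat_add]
    split_ifs
    · rfl
    · rw [add_mul, mul_add]; abel
    · rfl
  map_smul' c v := by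
    funext j
    rw [Pi.smul_apply, ← Matrix.of.symm_apply_apply (_ • _ : Fin 4 → Fin 4 → ℝ)]
    congr 1
    rw [← Matrix.smul_of, Equiv.apply_symm_apply]
    simp only [mat_smul, RingHom.id_apply]
    split_ifs
    · rfl
    · rw [smul_mul_assoc, mul_smul_comm, smul_add]
    · rfl

theorem mat_dfaceAmb {p : ℕ} (i : Fin (p + 2)) (h : N (p + 1)) (v : Amb (p + 1)) (j : Fin p) :
    mat (dfaceAmb i h v) j = if (j : ℕ) + 1 < i then mat v j.castSucc
      else if (j : ℕ) + 1 = i then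
        mat v j.castSucc * (h j.succ : Mat) + (h j.castSucc : Mat) * mat v j.succ
      else mat v j.succ := rfl

theorem hasDerivAt_face {p : ℕ} (i : Fin (p + 2)) {γ : ℝ → N (p + 1)} {t : ℝ} {v : Amb (p + 1)}
    (hγ : HasDerivAt (fun s => toAmb (γ s)) v t) :
    HasDerivAt (fun s => toAmb (face i (γ s))) (dfaceAmb i (γ t) v) t := by
  rw [hasDerivAt_toAmb_iff] at hγ ⊢
  intro j a b
  rw [mat_dfaceAmb]
  simp only [face]
  split_ifs
  · exact hγ _ a b
  · exact hasDerivAt_mul_entry (hγ _) (hγ _) a b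
  · exact hγ _ a b

theorem dfaceAmb_mem {p : ℕ} (i : Fin (p + 2)) (h : N (p + 1)) (v : Amb (p + 1))
    (hv : v ∈ tangent h) : dfaceAmb i h v ∈ tangent (face i h) := by
  intro j
  rw [mat_dfaceAmb]
  simp only [face]
  split_ifs
  · exact hv _
  · have e : ((h j.castSucc * h j.succ : SO4) : Mat)⁻¹
          * (mat v j.castSucc * (h j.succ : Mat) + (h j.castSucc : Mat) * mat v j.succ)
        = (h j.succ : Mat)⁻¹ * ((h j.castSucc : Mat)⁻¹ * mat v j.castSucc) * (h j.succ : Mat)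
          + (h j.succ : Mat)⁻¹ * mat v j.succ := by
      rw [Submonoid.coe_mul, Matrix.mul_inv_rev, mul_add]
      congr 1
      · simp only [Matrix.mul_assoc]
      · rw [Matrix.mul_assoc, ← Matrix.mul_assoc (h j.castSucc : Mat)⁻¹, inv_mul_self, Matrix.one_mul]
    rw [e]
    exact add_mem (inv_mul_mul_mem _ (hv _)) (hv _)
  · exact hv _

/-- The pull-back `ε_i^* : Ω^q(NSO(4)(p)) → Ω^q(NSO(4)(p+1))`. -/
def facePull {p : ℕ} (q : ℕ) (i : Fin (p + 2)) : Form p q →ₗ[ℝ] Form (p + 1) q :=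
  pullback q (face i) fun h => (dfaceAmb i h).restrict (dfaceAmb_mem i h)

/-- The simplicial differential `d' = ∑_{i=0}^{p+1} (-1)^i ε_i^*`. -/
def dSimp {p q : ℕ} (α : Form p q) : Form (p + 1) q :=
  ∑ i : Fin (p + 2), (-1 : ℝ) ^ (i : ℕ) • facePull q i α

/-! ### The conjugation action -/

/-- The conjugation action of `SO(4)` on `NSO(4)(p)`. -/
def conj {p : ℕ} (g : SO4) (h : N p) : N p := fun i => g * h i * g⁻¹

/-- The differential of the action of `g`, which is the restriction of a linear map of the
ambient vector space. -/
def dconjAmb (p : ℕ) (g : SO4) : Amb p →ₗ[ℝ] Amb p where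
  toFun v := fun i => Matrix.of.symm ((g : Mat) * mat v i * (g : Mat)⁻¹)
  map_add' v w := by
    funext i
    simp only [mat_add, mul_add, add_mul]
    rfl
  map_smul' c v := by
    funext i
    simp only [mat_smul, mul_smul_comm, smul_mul_assoc]
    rfl

theorem mat_dconjAmb {p : ℕ} (g : SO4) (v : Amb p) (i : Fin p) :
    mat (dconjAmb p g v) i = (g : Mat) * mat v i * (g : Mat)⁻¹ := rfl

theorem coe_inv_SO4 (g : SO4) : ((g⁻¹ : SO4) : Mat) = (g : Mat)⁻¹ := by
  symm
  apply Matrix.inv_eq_left_inv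
  rw [← Submonoid.coe_mul, inv_mul_cancel, Submonoid.coe_one]

theorem dconjAmb_mem {p : ℕ} (g : SO4) (h : N p) (v : Amb p) (hv : v ∈ tangent h) :
    dconjAmb p g v ∈ tangent (conj g h) := by
  intro i
  have e : ((conj g h i : SO4) : Mat)⁻¹ * mat (dconjAmb p g v) i
      = (g : Mat) * ((h i : Mat)⁻¹ * mat v i) * (g : Mat)⁻¹ := by
    rw [mat_dconjAmb, conj, ← coe_inv_SO4, mul_inv_rev, mul_inv_rev, inv_inv, Submonoid.coe_mul, Submonoid.coe_mul,
      coe_inv_SO4, coe_inv_SO4]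
    simp only [Matrix.mul_assoc]
    rw [← Matrix.mul_assoc (g : Mat)⁻¹ (g : Mat), inv_mul_self, Matrix.one_mul]
  rw [e]
  exact mul_mul_inv_mem g (hv i)

/-- Pull-back of forms along the action of `g`. -/
def conjPull (p q : ℕ) (g : SO4) : Form p q →ₗ[ℝ] Form p q :=
  pullback q (conj g) fun h => (dconjAmb p g).restrict (dconjAmb_mem g h)

/-- The adjoint action of `SO(4)` on `𝔰𝔬(4)`. -/
def Ad (g : SO4) (X : so4) : so4 := ⟨(g : Mat) * (X : Mat) * (g : Mat)⁻¹, mul_mul_inv_mem g X.2⟩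

/-- The vector field on `NSO(4)(p)` generated by `X ∈ 𝔰𝔬(4)`, namely
`X_M(h) = d/dt|_{t=0} exp(-tX) · h` (see `hasDerivAt_conj_exp`). -/
def fundVec {p : ℕ} (X : so4) (h : N p) : tangent h :=
  ⟨fun i => Matrix.of.symm ((h i : Mat) * (X : Mat) - (X : Mat) * (h i : Mat)), fun i => by
    have e : (h i : Mat)⁻¹ * ((h i : Mat) * (X : Mat) - (X : Mat) * (h i : Mat))
        = (X : Mat) - (h i : Mat)⁻¹ * (X : Mat) * (h i : Mat) := by
      rw [mul_sub, ← Matrix.mul_assoc, inv_mul_self, Matrix.one_mul, Matrix.mul_assoc]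
    rw [mat, Equiv.apply_symm_apply, e]
    exact sub_mem X.2 (inv_mul_mul_mem _ X.2)⟩

theorem hasDerivAt_conj_exp {p : ℕ} (X : so4) (h : N p) :
    HasDerivAt (fun t : ℝ =>
      toAmb (conj ⟨NormedSpace.exp (((-t) • X : so4) : Mat), exp_mem ((-t) • X)⟩ h))
      (fundVec X h : Amb p) 0 := by
  refine hasDerivAt_toAmb_iff.2 fun i a b => ?_
  have h0 := hasDerivAt_exp_entry (X : Mat)
  have h1 := fun a b => hasDerivAt_exp_entry (-(X : Mat)) a b
  have h2 := hasDerivAt_mul_entry (hasDerivAt_mul_entry h1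
    (G := fun _ => (h i : Mat)) (G' := 0) (fun a b => hasDerivAt_const _ _)) h0 a b
  have e : ∀ t : ℝ, ((⟨NormedSpace.exp (((-t) • X : so4) : Mat), exp_mem ((-t) • X)⟩ : SO4) : Mat)
      = NormedSpace.exp (t • -(X : Mat)) := fun t => by
    show NormedSpace.exp ((-t) • (X : Mat)) = _
    rw [neg_smul, smul_neg]
  have e' : ∀ t : ℝ,
      (((⟨NormedSpace.exp (((-t) • X : so4) : Mat), exp_mem ((-t) • X)⟩ : SO4)⁻¹ : SO4) : Mat)
      = NormedSpace.exp (t • (X : Mat)) := fun t => by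
    rw [coe_inv_SO4, e, smul_neg, ← Matrix.exp_neg, neg_neg]
  have h3 : mat (fundVec X h : Amb p) i = (h i : Mat) * (X : Mat) - (X : Mat) * (h i : Mat) := rfl
  have h4 : mat (fundVec X h : Amb p) i = (-(X : Mat) * (h i : Mat)
      + NormedSpace.exp ((0 : ℝ) • -(X : Mat)) * 0) * NormedSpace.exp ((0 : ℝ) • (X : Mat))
        + NormedSpace.exp ((0 : ℝ) • -(X : Mat)) * (h i : Mat) * (X : Mat) := by
    rw [h3, zero_smul, zero_smul, NormedSpace.exp_zero, mul_zero, add_zero, mul_one, one_mul,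
      neg_mul, sub_eq_neg_add]
  rw [h4]
  have e'' : ∀ t : ℝ, (((-t) • X : so4) : Mat) = t • -(X : Mat) := fun t => by
    show (-t) • (X : Mat) = _
    rw [neg_smul, smul_neg]
  simp only [conj, Submonoid.coe_mul, e']
  simp only [e'']
  exact h2

/-- The contraction `i_{X_M}` with the vector field generated by `X`. -/
def contract {p q : ℕ} (X : so4) (α : Form p (q + 1)) : Form p q :=
  fun h => (α h).curryLeft (fundVec X h)

/-! ### The equivariant simplicial de Rham complex -/

/-- `Ω^q(NSO(4)(p)) ⊗ S^r(𝔰𝔬(4)^*)`, as the space of homogeneous polynomial functions of degree `r`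
on `𝔰𝔬(4)` with values in `Ω^q(NSO(4)(p))`. -/
def PolyForm (p q r : ℕ) : Submodule ℝ (so4 → Form p q) :=
  Submodule.span ℝ {α | ∃ (l : Fin r → Module.Dual ℝ so4) (ω : Form p q), ω ∈ Omega p q ∧
    α = fun X => (∏ j, l j X) • ω}

/-- `(Ω^q(NSO(4)(p)) ⊗ S^r(𝔰𝔬(4)^*))^{SO(4)}`: the polynomial functions `α` that are invariant under
`(g · α)(X) = (g⁻¹)^* (α (Ad(g⁻¹) X))`. -/
def EquivForm (p q r : ℕ) : Submodule ℝ (so4 → Form p q) where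
  carrier := {α | α ∈ PolyForm p q r ∧ ∀ (g : SO4) (X : so4), conjPull p q g (α (Ad g X)) = α X}
  add_mem' := fun ha hb => ⟨add_mem ha.1 hb.1, fun g X => by
    rw [Pi.add_apply, Pi.add_apply, map_add, ha.2, hb.2]⟩
  zero_mem' := ⟨zero_mem _, fun g X => by rw [Pi.zero_apply, Pi.zero_apply, map_zero]⟩
  smul_mem' := fun c _ ha => ⟨Submodule.smul_mem _ c ha.1, fun g X => by
    rw [Pi.smul_apply, Pi.smul_apply, map_smul, ha.2]⟩

/-- Families indexed by the simplicial degree `p`, the form degree `q` and the polynomial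
degree `r`. -/
abbrev Family : Type := (p q r : ℕ) → so4 → Form p q

/-- `Ω^n_{SO(4)}(NSO(4)) = ⨁_{p + q + 2r = n} (Ω^q(NSO(4)(p)) ⊗ S^r(𝔰𝔬(4)^*))^{SO(4)}`, the degree `n`
part of the total complex. -/
def Cochain (n : ℕ) : Submodule ℝ Family where
  carrier := {c | ∀ p q r, c p q r ∈ EquivForm p q r ∧ (p + q + 2 * r ≠ n → c p q r = 0)}
  add_mem' := fun ha hb p q r => ⟨add_mem (ha p q r).1 (hb p q r).1, fun hn => by
    simp only [Pi.add_apply, (ha p q r).2 hn, (hb p q r).2 hn, add_zero]⟩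
  zero_mem' := fun _ _ _ => ⟨zero_mem _, fun _ => rfl⟩
  smul_mem' := fun c _ ha p q r => ⟨Submodule.smul_mem _ c (ha p q r).1, fun hn => by
    simp only [Pi.smul_apply, (ha p q r).2 hn, smul_zero]⟩

/-- The `d'` part of the total differential. -/
def partSimp (c : Family) : Family
  | 0, _, _ => fun _ => 0
  | p + 1, q, r => fun X => dSimp (c p q r X)

/-- The part of the total differential that comes from the exterior differential, without sign. -/
def partExt (c : Family) : Family
  | _, 0, _ => fun _ => 0
  | p, q + 1, r => fun X => extd (c p q r X)

/-- The contraction part `X ↦ i_{X_M} (c(X))`, which raises the polynomial degree by one. -/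
def partContract (c : Family) : Family
  | _, _, 0 => fun _ => 0
  | p, q, r + 1 => fun X => contract X (c p (q + 1) r X)

/-- The differential `d' + (-1)^p d_G` of the total complex, where `(d_G α)(X) = (d - i_{X_M})(α(X))`
is the Cartan differential on `NSO(4)(p)`. -/
def totalD (c : Family) : Family := fun p q r X =>
  partSimp c p q r X + (-1 : ℝ) ^ p • (partExt c p q r X - partContract c p q r X)

/-- `c` is a cocycle in `Ω^n_{SO(4)}(NSO(4))`. -/
def IsCocycle (n : ℕ) (c : Family) : Prop := c ∈ Cochain n ∧ totalD c = 0

/-- The family with the single component `α`, in the tridegree `(p, q, r)`. -/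
def single (p q r : ℕ) (α : so4 → Form p q) : Family := Pi.single p (Pi.single q (Pi.single r α))

/-! ### The forms `E_{1,3}`, `E_{2,2}` and `μ` -/

/-- Families of linear forms on the tangent spaces. -/
abbrev Covector (p : ℕ) : Type := (h : N p) → tangent h →ₗ[ℝ] ℝ

/-- The wedge product `f₁ ∧ ⋯ ∧ f_q` of `1`-forms, `(v₁, …, v_q) ↦ det (f_i (v_j))`. -/
def wedge {p q : ℕ} (f : Fin q → Covector p) : Form p q :=
  fun h => Matrix.detRowAlternating.compLinearMap (LinearMap.pi fun i => f i h)

theorem wedge_apply {p q : ℕ} (f : Fin q → Covector p) (h : N p) (v : Fin q → tangent h) :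
    wedge f h v = Matrix.det (Matrix.of fun j i => f i h (v j)) := rfl

/-- The `(a, b)` entry of the matrix valued `1`-form `h_i⁻¹ dh_i` on `NSO(4)(p)`. -/
def lmc {p : ℕ} (i : Fin p) (a b : Fin 4) : Covector p := fun h =>
  { toFun := fun v => ((h i : Mat)⁻¹ * mat (v : Amb p) i) a b
    map_add' := fun v w => by
      rw [Submodule.coe_add, mat_add, mul_add, Matrix.add_apply]
    map_smul' := fun c v => by
      rw [Submodule.coe_smul, mat_smul, mul_smul_comm, Matrix.smul_apply, RingHom.id_apply] }

/-- The `(a, b)` entry of the matrix valued `1`-form `dh_i h_i⁻¹` on `NSO(4)(p)`. -/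
def rmc {p : ℕ} (i : Fin p) (a b : Fin 4) : Covector p := fun h =>
  { toFun := fun v => (mat (v : Amb p) i * (h i : Mat)⁻¹) a b
    map_add' := fun v w => by
      rw [Submodule.coe_add, mat_add, add_mul, Matrix.add_apply]
    map_smul' := fun c v => by
      rw [Submodule.coe_smul, mat_smul, smul_mul_assoc, Matrix.smul_apply, RingHom.id_apply] }

/-- The sign of a permutation as a real number. -/
def sgn (τ : Equiv.Perm (Fin 4)) : ℝ := ((Equiv.Perm.sign τ : ℤ) : ℝ)

/-- The form `(h⁻¹dh)_{ab} ∧ ((h⁻¹dh)²)_{cd}` on `SO(4)`, where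
`((h⁻¹dh)²)_{cd} = ∑_e (h⁻¹dh)_{ce} ∧ (h⁻¹dh)_{ed}`. -/
def cubic (a b c d : Fin 4) : Form 1 3 :=
  ∑ e : Fin 4, wedge ![lmc 0 a b, lmc 0 c e, lmc 0 e d]

/-- `E_{1,3} ∈ Ω³(SO(4))`. -/
def E13 : Form 1 3 :=
  (1 / (192 * Real.pi ^ 2)) • ∑ τ : Equiv.Perm (Fin 4), sgn τ •
    (cubic (τ 0) (τ 1) (τ 2) (τ 3) + cubic (τ 2) (τ 3) (τ 0) (τ 1))

/-- `E_{2,2} ∈ Ω²(SO(4) × SO(4))`. -/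
def E22 : Form 2 2 :=
  (-1 / (64 * Real.pi ^ 2)) • ∑ τ : Equiv.Perm (Fin 4), sgn τ •
    (wedge ![lmc 0 (τ 0) (τ 1), rmc 1 (τ 2) (τ 3)] + wedge ![lmc 0 (τ 2) (τ 3), rmc 1 (τ 0) (τ 1)])

/-- `μ : 𝔰𝔬(4) → Ω¹(SO(4))`. -/
def mu (X : so4) : Form 1 1 :=
  (-1 / (64 * Real.pi ^ 2)) • ∑ τ : Equiv.Perm (Fin 4), sgn τ •
      ((X : Mat) (τ 0) (τ 1) • wedge ![lmc 0 (τ 2) (τ 3)]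
        + (X : Mat) (τ 2) (τ 3) • wedge ![lmc 0 (τ 0) (τ 1)])
  - (1 / (64 * Real.pi ^ 2)) • ∑ τ : Equiv.Perm (Fin 4), sgn τ •
      ((X : Mat) (τ 0) (τ 1) • wedge ![rmc 0 (τ 2) (τ 3)]
        + (X : Mat) (τ 2) (τ 3) • wedge ![rmc 0 (τ 0) (τ 1)])

end EquivariantSimplicial

end

/-!
On `4 × 4` matrices let `⟨A, B⟩ = ∑_τ sgn(τ) A_{τ(1)τ(2)} B_{τ(3)τ(4)}` (`pairing`). It is symmetric, it is
invariant under conjugation by `SO(4)` because `⟨gAgᵀ, gBgᵀ⟩ = det(g) ⟨A, B⟩` (`pairing_conj`), and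
consequently `⟨A, [B, C]⟩` is invariant under cyclic permutations of skew-symmetric matrices
(`pairing_lie_cyclic`). With `θ = h⁻¹dh`, `ρ = dh h⁻¹ = hθh⁻¹` and `κ = 1/(32π²)`, the three forms are
`E_{1,3} = κ ⟨θ, [θ, θ]⟩`, that is, `(u, v, w) ↦ κ ⟨θ(u), [θ(v), θ(w)]⟩`, further `E_{2,2} = -κ ⟨θ₁ ∧ ρ₂⟩` and
`μ(X) = -κ ⟨X, θ + ρ⟩` (`E13_apply`, `E22_apply`, `mu_apply`).

Smoothness and exterior derivatives come from one construction: each form is a constant alternating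
form evaluated on the left and right Maurer–Cartan forms (`mcForm`), and the latter extend to the
ambient vector space bilinearly in the base point and the vector. So `extd_mcForm` gives the exterior
derivative in closed form, and the Maurer–Cartan equations make it explicit on tangent vectors.

The total differential of the cochain has six components that are not zero for trivial reasons, and
they vanish by the following identities:
`d E_{1,3} = 0` (the Jacobi identity), `d μ(X) = i_X E_{1,3}` and `i_X μ(X) = 0` (from
`i_X θ = X - h⁻¹Xh` and `i_X ρ = hXh⁻¹ - X`), `d' E_{1,3} = -d E_{2,2}`, `d' μ(X) = i_X E_{2,2}` and `d' E_{2,2} = 0`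
(from `θ ↦ h₂⁻¹θ₁h₂ + θ₂` and `ρ ↦ ρ₁ + h₁ρ₂h₁⁻¹` under multiplication). Each of them is an identity for the
pairing that follows from its invariance.
-/

noncomputable section

namespace EquivariantSimplicial

attribute [local instance] LieRing.ofAssociativeRing

/-! ### The invariant pairing -/

/-- The bilinear form `⟨A, B⟩ = ∑_τ sgn(τ) A_{τ(1)τ(2)} B_{τ(3)τ(4)}` on `4 × 4` matrices. On skew-symmetric
matrices it is a multiple of the polarization of the Pfaffian. -/
def pairing : Mat →ₗ[ℝ] Mat →ₗ[ℝ] ℝ :=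
  LinearMap.mk₂ ℝ (fun A B => ∑ τ : Equiv.Perm (Fin 4), sgn τ * (A (τ 0) (τ 1) * B (τ 2) (τ 3)))
    (fun A A' B => by
      simp only [Matrix.add_apply, add_mul, mul_add, Finset.sum_add_distrib])
    (fun c A B => by
      simp only [Matrix.smul_apply, smul_eq_mul, Finset.mul_sum]
      exact Finset.sum_congr rfl fun _ _ => by ring)
    (fun A B B' => by
      simp only [Matrix.add_apply, mul_add, Finset.sum_add_distrib])
    (fun c A B => by
      simp only [Matrix.smul_apply, smul_eq_mul, Finset.mul_sum]
      exact Finset.sum_congr rfl fun _ _ => by ring)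

theorem pairing_apply (A B : Mat) :
    pairing A B = ∑ τ : Equiv.Perm (Fin 4), sgn τ * (A (τ 0) (τ 1) * B (τ 2) (τ 3)) := rfl

theorem pairing_comm (A B : Mat) : pairing A B = pairing B A := by
  let ρ : Equiv.Perm (Fin 4) := Equiv.swap 0 2 * Equiv.swap 1 3
  have hρ : Equiv.Perm.sign ρ = 1 := by decide
  rw [pairing_apply, pairing_apply, ← Equiv.sum_comp (Equiv.mulRight ρ)]
  refine Finset.sum_congr rfl fun τ _ => ?_
  have h0 : ρ 0 = 2 := by decide
  have h1 : ρ 1 = 3 := by decide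
  have h2 : ρ 2 = 0 := by decide
  have h3 : ρ 3 = 1 := by decide
  simp only [Equiv.coe_mulRight, sgn, Equiv.Perm.sign_mul, hρ, mul_one, Equiv.Perm.mul_apply,
    h0, h1, h2, h3]
  ring

set_option maxHeartbeats 1000000 in
/-- The `24` terms of the pairing, collected: only the skew-symmetric parts of `A` and `B` enter. -/
theorem pairing_expand (A B : Mat) : pairing A B =
    (A 0 1 - A 1 0) * (B 2 3 - B 3 2) - (A 0 2 - A 2 0) * (B 1 3 - B 3 1)
      + (A 0 3 - A 3 0) * (B 1 2 - B 2 1) + (A 1 2 - A 2 1) * (B 0 3 - B 3 0)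
      - (A 1 3 - A 3 1) * (B 0 2 - B 2 0) + (A 2 3 - A 3 2) * (B 0 1 - B 1 0) := by
  have h2 : ∀ (n : ℕ) (p : Fin (n + 3)) (e : Equiv.Perm (Fin (n + 2))),
      Equiv.Perm.decomposeFin.symm (p, e) 2 = Equiv.swap 0 p (e 1).succ :=
    fun _ p e => Equiv.Perm.decomposeFin_symm_apply_succ e p 1
  have h3 : ∀ (p : Fin 4) (e : Equiv.Perm (Fin 3)),
      Equiv.Perm.decomposeFin.symm (p, e) 3 = Equiv.swap 0 p (e 2).succ :=
    fun p e => Equiv.Perm.decomposeFin_symm_apply_succ e p 2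
  rw [pairing_apply]
  simp only [Finset.univ_perm_fin_succ, Finset.sum_map, Finset.sum_product,
    ← Finset.univ_product_univ, Fin.sum_univ_succ, sgn]
  simp [h2, h3, Fin.succ_ne_zero, Equiv.swap_apply_def]
  ring

/-- On matrices of rank one the pairing is a determinant. -/
theorem pairing_vecMulVec (w : Fin 4 → Fin 4 → ℝ) :
    pairing (Matrix.vecMulVec (w 0) (w 1)) (Matrix.vecMulVec (w 2) (w 3)) = (Matrix.of w).det := by
  rw [pairing_apply, ← Matrix.det_transpose, Matrix.det_apply']
  refine Finset.sum_congr rfl fun τ _ => ?_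
  simp only [Matrix.vecMulVec_apply, Fin.prod_univ_four, Matrix.transpose_apply, Matrix.of_apply, sgn]
  ring

/-- The pairing is multiplied by `det g` under `A ↦ g A gᵀ`. By bilinearity this is a statement about
matrix units, which are of rank one, and there it is the multiplicativity of the determinant. -/
theorem pairing_conj (g A B : Mat) :
    pairing (g * A * g.transpose) (g * B * g.transpose) = g.det * pairing A B := by
  have conj_single : ∀ i j : Fin 4, g * Matrix.single i j 1 * g.transpose
      = Matrix.vecMulVec (g.col i) (g.col j) := by
    intro i j
    ext a b
    simp [Matrix.mul_apply, Matrix.single_apply, Matrix.vecMulVec_apply, ite_and]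
  have key : ∀ i j k l : Fin 4,
      pairing (g * Matrix.single i j 1 * g.transpose) (g * Matrix.single k l 1 * g.transpose)
        = g.det * pairing (Matrix.single i j 1) (Matrix.single k l 1) := by
    intro i j k l
    have h1 : ∀ i j : Fin 4, (Matrix.single i j 1 : Mat)
        = Matrix.vecMulVec (Pi.single i 1) (Pi.single j 1) :=
      fun i j => Matrix.single_eq_single_vecMulVec_single i j
    rw [conj_single, conj_single, h1, h1]
    have e1 := pairing_vecMulVec fun r => g.col (![i, j, k, l] r)
    have e2 := pairing_vecMulVec fun r => Pi.single (![i, j, k, l] r) 1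
    have e3 : (Matrix.of fun r => g.col (![i, j, k, l] r))
        = (Matrix.of fun r => Pi.single (![i, j, k, l] r) (1 : ℝ)) * g.transpose := by
      ext a b
      simp [Matrix.mul_apply, Pi.single_apply]
    rw [e3, Matrix.det_mul, Matrix.det_transpose, mul_comm, ← e2] at e1
    exact e1
  rw [Matrix.matrix_eq_sum_single A, Matrix.matrix_eq_sum_single B]
  have h2 : ∀ (i j : Fin 4) (c : ℝ), (Matrix.single i j c : Mat) = c • Matrix.single i j 1 := by
    intro i j c
    rw [Matrix.smul_single, smul_eq_mul, mul_one]
  simp only [h2 _ _ (A _ _), h2 _ _ (B _ _), Finset.mul_sum, Finset.sum_mul, mul_smul_comm,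
    smul_mul_assoc, map_sum, map_smul, LinearMap.sum_apply, LinearMap.smul_apply, key, smul_eq_mul]
  refine Finset.sum_congr rfl fun _ _ => Finset.sum_congr rfl fun _ _ =>
    Finset.sum_congr rfl fun _ _ => Finset.sum_congr rfl fun _ _ => ?_
  ring

theorem so4_apply {C : Mat} (hC : C ∈ so4) (a b : Fin 4) : C b a = -C a b := 
  congrFun (congrFun ((LieAlgebra.Orthogonal.mem_so _ _ _).1 hC) a) b

/-- The pairing is invariant under the adjoint action of `𝔰𝔬(4)`. Only the matrix `C` that acts has to be
skew-symmetric. -/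
theorem pairing_lie_left {C : Mat} (hC : C ∈ so4) (A B : Mat) :
    pairing ⁅C, A⁆ B = -pairing A ⁅C, B⁆ := by
  rw [Ring.lie_def, Ring.lie_def]
  have h10 := so4_apply hC 0 1
  have h20 := so4_apply hC 0 2
  have h30 := so4_apply hC 0 3
  have h21 := so4_apply hC 1 2
  have h31 := so4_apply hC 1 3
  have h32 := so4_apply hC 2 3
  have h0 : C 0 0 = 0 := by linarith [so4_apply hC 0 0]
  have h1 : C 1 1 = 0 := by linarith [so4_apply hC 1 1]
  have h2 : C 2 2 = 0 := by linarith [so4_apply hC 2 2]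
  have h3 : C 3 3 = 0 := by linarith [so4_apply hC 3 3]
  simp only [pairing_expand, Matrix.sub_apply, Matrix.mul_apply, Fin.sum_univ_four, h10, h20, h30,
    h21, h31, h32, h0, h1, h2, h3]
  ring

theorem pairing_conj_SO4 (g : SO4) (A B : Mat) :
    pairing ((g : Mat) * A * (g : Mat)⁻¹) ((g : Mat) * B * (g : Mat)⁻¹) = pairing A B := by
  rw [inv_eq_transpose, pairing_conj, (Matrix.mem_specialOrthogonalGroup_iff.1 g.2).2, one_mul]

theorem pairing_conj_left (g : SO4) (A B : Mat) :
    pairing ((g : Mat) * A * (g : Mat)⁻¹) B = pairing A ((g : Mat)⁻¹ * B * (g : Mat)) := by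
  rw [← pairing_conj_SO4 g A]
  congr 1
  simp only [Matrix.mul_assoc, mul_inv_self, Matrix.mul_one]
  rw [← Matrix.mul_assoc, mul_inv_self, Matrix.one_mul]

theorem pairing_conj_right (g : SO4) (A B : Mat) :
    pairing A ((g : Mat) * B * (g : Mat)⁻¹) = pairing ((g : Mat)⁻¹ * A * (g : Mat)) B := by
  rw [pairing_comm, pairing_conj_left, pairing_comm]

/-- The trilinear form `⟨A, [B, C]⟩` is invariant under cyclic permutations. -/
theorem pairing_lie_cyclic {B : Mat} (hB : B ∈ so4) (A C : Mat) :
    pairing A ⁅B, C⁆ = pairing C ⁅A, B⁆ := by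
  rw [pairing_comm, pairing_lie_left hB, ← lie_skew B A, map_neg, neg_neg]

/-! ### Exterior derivatives of forms with bilinear coefficients -/

/-- A family of alternating forms on a finite-dimensional space is smooth if all its evaluations are:
the evaluations on tuples of basis vectors are the coordinates of a linear embedding. -/
theorem contDiff_of_forall_apply {E F : Type*} [NormedAddCommGroup E] [NormedSpace ℝ E]
    [NormedAddCommGroup F] [NormedSpace ℝ F] [FiniteDimensional ℝ F] {q : ℕ} {n : WithTop ℕ∞}
    {ω : E → F [⋀^Fin q]→L[ℝ] ℝ} (hω : ∀ v, ContDiff ℝ n fun x => ω x v) : ContDiff ℝ n ω := by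
  let e := Module.finBasis ℝ F
  let ev : (F [⋀^Fin q]→L[ℝ] ℝ) →ₗ[ℝ] ((Fin q → Fin (Module.finrank ℝ F)) → ℝ) :=
    { toFun := fun η s => η fun j => e (s j)
      map_add' := fun _ _ => rfl
      map_smul' := fun _ _ => rfl }
  have hev : LinearMap.ker ev = ⊥ := by
    refine LinearMap.ker_eq_bot.2 fun η ζ h => ?_
    apply ContinuousAlternatingMap.toAlternatingMap_injective
    apply AlternatingMap.coe_multilinearMap_injective
    exact Module.Basis.ext_multilinear (fun _ => e) fun s => congrFun h s
  obtain ⟨g, hg⟩ := LinearMap.exists_leftInverse_of_injective ev hev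
  have h1 : ω = fun x => LinearMap.toContinuousLinearMap g (ev (ω x)) := by
    funext x
    exact (LinearMap.congr_fun hg (ω x)).symm
  rw [h1]
  exact (ContinuousLinearMap.contDiff _).comp (contDiff_pi.2 fun s => hω _)

section Bilinear

variable {E W : Type*} [NormedAddCommGroup E] [NormedSpace ℝ E] [FiniteDimensional ℝ E]
  [NormedAddCommGroup W] [NormedSpace ℝ W] {q : ℕ}

theorem contDiff_compContinuousLinearMap (T : W [⋀^Fin q]→L[ℝ] ℝ) (L : E →L[ℝ] E →L[ℝ] W)
    {n : WithTop ℕ∞} : ContDiff ℝ n fun x => T.compContinuousLinearMap (L x) := by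
  refine contDiff_of_forall_apply fun v => ?_
  exact T.toContinuousMultilinearMap.contDiff.comp
    (contDiff_pi.2 fun j => (L.flip (v j)).contDiff)

/-- The exterior derivative of a form `x ↦ T(L(x, ·), …, L(x, ·))`, where `T` is a constant alternating form
and `L` is bilinear: in the direction `u`, the derivative of `L(x, w)` is `L(u, w)`. -/
theorem extDeriv_compContinuousLinearMap (T : W [⋀^Fin q]→L[ℝ] ℝ) (L : E →L[ℝ] E →L[ℝ] W)
    (x : E) (v : Fin (q + 1) → E) :
    extDeriv (fun x => T.compContinuousLinearMap (L x)) x v =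
      ∑ i, (-1) ^ i.val * ∑ j, T (Function.update (fun k => L x (i.removeNth v k)) j
        (L (v i) (i.removeNth v j))) := by
  rw [extDeriv_apply ((contDiff_compContinuousLinearMap T L).differentiable one_ne_zero x)]
  refine Finset.sum_congr rfl fun i _ => ?_
  have h1 : HasFDerivAt (fun x => T fun j => L x (i.removeNth v j)) _ x :=
    (T.hasFDerivAt fun j => L x (i.removeNth v j)).comp x
      (hasFDerivAt_pi.2 fun j => (L.flip (i.removeNth v j)).hasFDerivAt)
  rw [show (fun x => (T.compContinuousLinearMap (L x)) (i.removeNth v))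
    = fun x => T fun j => L x (i.removeNth v j) from rfl, h1.fderiv, zsmul_eq_mul]
  push_cast
  congr 1
  exact ContinuousMultilinearMap.linearDeriv_apply _ _ _

end Bilinear

/-! ### Forms built from the Maurer–Cartan forms -/

/-- A bilinear extension of the left and right Maurer–Cartan forms `h_i⁻¹ dh_i` and `dh_i h_i⁻¹` to the
ambient vector space: at `x`, the value at `v` has the components `(x_iᵀ v_i - v_iᵀ x_i) / 2` and
`(v_i x_iᵀ - x_i v_iᵀ) / 2`. They are skew-symmetric for all `x` and `v`, not only on the submanifold, so
that their derivatives are skew-symmetric as well. -/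
def mcAmb (p : ℕ) : Amb p →ₗ[ℝ] Amb p →ₗ[ℝ] Amb p × Amb p :=
  LinearMap.mk₂ ℝ (fun x v =>
      (fun i => Matrix.of.symm
        ((1 / 2 : ℝ) • ((mat x i).transpose * mat v i - (mat v i).transpose * mat x i)),
       fun i => Matrix.of.symm
        ((1 / 2 : ℝ) • (mat v i * (mat x i).transpose - mat x i * (mat v i).transpose))))
    (fun x y v => by
      ext i a b <;> simp [mat_add, add_mul, mul_add] <;> ring)
    (fun c x v => by
      ext i a b <;> simp [mat_smul] <;> ring)
    (fun x v w => by
      ext i a b <;> simp [mat_add, add_mul, mul_add] <;> ring)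
    (fun c x v => by
      ext i a b <;> simp [mat_smul] <;> ring)

/-- `mcAmb` as a continuous bilinear map. -/
def mcCLM (p : ℕ) : Amb p →L[ℝ] Amb p →L[ℝ] Amb p × Amb p :=
  LinearMap.toContinuousLinearMap
    ((LinearMap.toContinuousLinearMap : (Amb p →ₗ[ℝ] Amb p × Amb p) ≃ₗ[ℝ] _).toLinearMap ∘ₗ mcAmb p)

theorem mat_mcCLM_fst {p : ℕ} (x v : Amb p) (i : Fin p) : mat (mcCLM p x v).1 i
    = (1 / 2 : ℝ) • ((mat x i).transpose * mat v i - (mat v i).transpose * mat x i) := rfl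

theorem mat_mcCLM_snd {p : ℕ} (x v : Amb p) (i : Fin p) : mat (mcCLM p x v).2 i
    = (1 / 2 : ℝ) • (mat v i * (mat x i).transpose - mat x i * (mat v i).transpose) := rfl

/-- The value `h_i⁻¹ v_i` at `v` of the matrix valued form `h_i⁻¹ dh_i`. -/
def lmcMat {p : ℕ} (h : N p) (v : Amb p) (i : Fin p) : Mat := (h i : Mat)⁻¹ * mat v i

/-- The value `v_i h_i⁻¹` at `v` of the matrix valued form `dh_i h_i⁻¹`. -/
def rmcMat {p : ℕ} (h : N p) (v : Amb p) (i : Fin p) : Mat := mat v i * (h i : Mat)⁻¹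

theorem lmcMat_mem {p : ℕ} {h : N p} {v : Amb p} (hv : v ∈ tangent h) (i : Fin p) :
    lmcMat h v i ∈ so4 := hv i

theorem rmcMat_eq {p : ℕ} (h : N p) (v : Amb p) (i : Fin p) :
    rmcMat h v i = (h i : Mat) * lmcMat h v i * (h i : Mat)⁻¹ := by
  rw [rmcMat, lmcMat, ← Matrix.mul_assoc, mul_inv_self, Matrix.one_mul]

theorem rmcMat_mem {p : ℕ} {h : N p} {v : Amb p} (hv : v ∈ tangent h) (i : Fin p) :
    rmcMat h v i ∈ so4 := by
  rw [rmcMat_eq]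
  exact mul_mul_inv_mem _ (hv i)

theorem mat_eq_mul_lmcMat {p : ℕ} (h : N p) (v : Amb p) (i : Fin p) :
    mat v i = (h i : Mat) * lmcMat h v i := by
  rw [lmcMat, ← Matrix.mul_assoc, mul_inv_self, Matrix.one_mul]

theorem mat_eq_rmcMat_mul {p : ℕ} (h : N p) (v : Amb p) (i : Fin p) :
    mat v i = rmcMat h v i * (h i : Mat) := by
  rw [rmcMat, Matrix.mul_assoc, inv_mul_self, Matrix.mul_one]

theorem mul_transpose_self (g : SO4) : (g : Mat) * (g : Mat).transpose = 1 := by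
  rw [← inv_eq_transpose, mul_inv_self]

theorem transpose_mul_eq_lmc {p : ℕ} {h : N p} {u : Amb p} (hu : u ∈ tangent h) (v : Amb p)
    (i : Fin p) : (mat u i).transpose * mat v i = -(lmcMat h u i * lmcMat h v i) := by
  rw [mat_eq_mul_lmcMat h u, mat_eq_mul_lmcMat h v, Matrix.transpose_mul,
    (LieAlgebra.Orthogonal.mem_so _ _ _).1 (lmcMat_mem hu i), Matrix.mul_assoc,
    ← Matrix.mul_assoc _ (h i : Mat), transpose_mul_self, Matrix.one_mul, neg_mul]

theorem mul_transpose_eq_rmc {p : ℕ} {h : N p} {u v : Amb p} (hv : v ∈ tangent h)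
    (i : Fin p) : mat u i * (mat v i).transpose = -(rmcMat h u i * rmcMat h v i) := by
  rw [mat_eq_rmcMat_mul h u, mat_eq_rmcMat_mul h v, Matrix.transpose_mul,
    (LieAlgebra.Orthogonal.mem_so _ _ _).1 (rmcMat_mem hv i), Matrix.mul_assoc,
    ← Matrix.mul_assoc (h i : Mat), mul_transpose_self, Matrix.one_mul, mul_neg]

theorem mcCLM_toAmb_fst {p : ℕ} {h : N p} {v : Amb p} (hv : v ∈ tangent h) (i : Fin p) :
    mat (mcCLM p (toAmb h) v).1 i = lmcMat h v i := by
  have h1 : (mat (toAmb h) i).transpose * mat v i = lmcMat h v i := by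
    rw [mat_toAmb, ← inv_eq_transpose]; rfl
  have h2 : (mat v i).transpose * mat (toAmb h) i = -lmcMat h v i := by
    rw [← (LieAlgebra.Orthogonal.mem_so _ _ _).1 (lmcMat_mem hv i), ← h1, Matrix.transpose_mul,
      Matrix.transpose_transpose]
  rw [mat_mcCLM_fst, h1, h2]
  module

theorem mcCLM_toAmb_snd {p : ℕ} {h : N p} {v : Amb p} (hv : v ∈ tangent h) (i : Fin p) :
    mat (mcCLM p (toAmb h) v).2 i = rmcMat h v i := by
  have h1 : mat v i * (mat (toAmb h) i).transpose = rmcMat h v i := by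
    rw [mat_toAmb, ← inv_eq_transpose]; rfl
  have h2 : mat (toAmb h) i * (mat v i).transpose = -rmcMat h v i := by
    rw [← (LieAlgebra.Orthogonal.mem_so _ _ _).1 (rmcMat_mem hv i), ← h1, Matrix.transpose_mul,
      Matrix.transpose_transpose]
  rw [mat_mcCLM_snd, h1, h2]
  module

/-- The bilinear extension at two tangent vectors. With `mcCLM_tangent_snd` this is the Maurer–Cartan
equation: `d(h⁻¹dh)(u, v) = -[h⁻¹u, h⁻¹v]` and `d(dh h⁻¹)(u, v) = [uh⁻¹, vh⁻¹]` are the alternations of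
the two formulas. -/
theorem mcCLM_tangent_fst {p : ℕ} {h : N p} {u v : Amb p} (hu : u ∈ tangent h)
    (hv : v ∈ tangent h) (i : Fin p) : mat (mcCLM p u v).1 i
      = (-1 / 2 : ℝ) • ⁅lmcMat h u i, lmcMat h v i⁆ := by
  rw [mat_mcCLM_fst, transpose_mul_eq_lmc hu, transpose_mul_eq_lmc hv, Ring.lie_def]
  module

theorem mcCLM_tangent_snd {p : ℕ} {h : N p} {u v : Amb p} (hu : u ∈ tangent h)
    (hv : v ∈ tangent h) (i : Fin p) : mat (mcCLM p u v).2 i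
      = (1 / 2 : ℝ) • ⁅rmcMat h u i, rmcMat h v i⁆ := by
  rw [mat_mcCLM_snd, mul_transpose_eq_rmc hu, mul_transpose_eq_rmc hv, Ring.lie_def]
  module

/-- The form on `NSO(4)(p)` that is obtained by evaluating a constant alternating form `T` on the left and
right Maurer–Cartan forms. -/
def mcForm {p q : ℕ} : ((Amb p × Amb p) [⋀^Fin q]→L[ℝ] ℝ) →ₗ[ℝ] Form p q where
  toFun T := restrict fun x => T.compContinuousLinearMap (mcCLM p x)
  map_add' _ _ := rfl
  map_smul' _ _ := rfl

theorem mcForm_mem {p q : ℕ} (T : (Amb p × Amb p) [⋀^Fin q]→L[ℝ] ℝ) : mcForm T ∈ Omega p q :=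
  ⟨_, contDiff_compContinuousLinearMap T (mcCLM p), rfl⟩

theorem extd_mcForm {p q : ℕ} (T : (Amb p × Amb p) [⋀^Fin q]→L[ℝ] ℝ) (h : N p)
    (v : Fin (q + 1) → tangent h) :
    extd (mcForm T) h v = ∑ i, (-1) ^ i.val *
      ∑ j, T (Function.update (fun k => mcCLM p (toAmb h) (i.removeNth v k)) j
        (mcCLM p (v i) (i.removeNth v j))) := by
  rw [show mcForm T = restrict fun x => T.compContinuousLinearMap (mcCLM p x) from rfl,
    extd_restrict (contDiff_compContinuousLinearMap T (mcCLM p))]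
  exact extDeriv_compContinuousLinearMap T (mcCLM p) (toAmb h) fun j => (v j : Amb p)

/-- The wedge product of continuous linear forms, with the normalization of `wedge`. -/
def wedgeCLM {W : Type*} [NormedAddCommGroup W] [NormedSpace ℝ W] {q : ℕ}
    (f : Fin q → W →L[ℝ] ℝ) : W [⋀^Fin q]→L[ℝ] ℝ :=
  { (Matrix.detRowAlternating (n := Fin q) (R := ℝ)).compLinearMap
      (LinearMap.pi fun i => (f i : W →ₗ[ℝ] ℝ)) with
    cont := by
      show Continuous fun v : Fin q → W => Matrix.det (Matrix.of fun j i => f i (v j))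
      exact Continuous.matrix_det (continuous_pi fun j => continuous_pi fun i =>
        (f i).continuous.comp (continuous_apply j)) }

theorem wedgeCLM_apply {W : Type*} [NormedAddCommGroup W] [NormedSpace ℝ W] {q : ℕ}
    (f : Fin q → W →L[ℝ] ℝ) (v : Fin q → W) :
    wedgeCLM f v = Matrix.det (Matrix.of fun j i => f i (v j)) := rfl

/-- The `(a, b)` entry of the `i`-th left component. -/
def leftEntry {p : ℕ} (i : Fin p) (a b : Fin 4) : (Amb p × Amb p) →L[ℝ] ℝ :=
  LinearMap.toContinuousLinearMap
    { toFun := fun w => mat w.1 i a b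
      map_add' := fun _ _ => rfl
      map_smul' := fun _ _ => rfl }

/-- The `(a, b)` entry of the `i`-th right component. -/
def rightEntry {p : ℕ} (i : Fin p) (a b : Fin 4) : (Amb p × Amb p) →L[ℝ] ℝ :=
  LinearMap.toContinuousLinearMap
    { toFun := fun w => mat w.2 i a b
      map_add' := fun _ _ => rfl
      map_smul' := fun _ _ => rfl }

theorem leftEntry_apply {p : ℕ} (i : Fin p) (a b : Fin 4) (w : Amb p × Amb p) :
    leftEntry i a b w = mat w.1 i a b := rfl

theorem rightEntry_apply {p : ℕ} (i : Fin p) (a b : Fin 4) (w : Amb p × Amb p) :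
    rightEntry i a b w = mat w.2 i a b := rfl

theorem lmc_apply {p : ℕ} (i : Fin p) (a b : Fin 4) (h : N p) (v : tangent h) :
    lmc i a b h v = lmcMat h v i a b := rfl

theorem rmc_apply {p : ℕ} (i : Fin p) (a b : Fin 4) (h : N p) (v : tangent h) :
    rmc i a b h v = rmcMat h v i a b := rfl

theorem mcForm_apply {p q : ℕ} (T : (Amb p × Amb p) [⋀^Fin q]→L[ℝ] ℝ) (h : N p)
    (v : Fin q → tangent h) : mcForm T h v = T fun j => mcCLM p (toAmb h) (v j) := rfl

/-! ### The three forms in terms of the pairing -/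

/-- The normalizing constant `1 / (32 π²)` that `E_{1,3}`, `E_{2,2}` and `μ` have in common when they are
written in terms of the pairing. -/
def kappa : ℝ := 1 / (32 * Real.pi ^ 2)

/-- The constant alternating form from which `cubic a b c d` is built. -/
def cubicCLM (a b c d : Fin 4) : (Amb 1 × Amb 1) [⋀^Fin 3]→L[ℝ] ℝ :=
  ∑ e : Fin 4, wedgeCLM ![leftEntry 0 a b, leftEntry 0 c e, leftEntry 0 e d]

theorem cubicCLM_apply (a b c d : Fin 4) (w : Fin 3 → Amb 1 × Amb 1) :
    cubicCLM a b c d w =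
      mat (w 0).1 0 a b * ⁅mat (w 1).1 0, mat (w 2).1 0⁆ c d
      + mat (w 1).1 0 a b * ⁅mat (w 2).1 0, mat (w 0).1 0⁆ c d
      + mat (w 2).1 0 a b * ⁅mat (w 0).1 0, mat (w 1).1 0⁆ c d := by
  simp only [cubicCLM, ContinuousAlternatingMap.sum_apply, wedgeCLM_apply, Matrix.det_fin_three,
    Ring.lie_def, Matrix.sub_apply, Matrix.mul_apply, mul_sub, Finset.mul_sum,
    ← Finset.sum_add_distrib, ← Finset.sum_sub_distrib]
  refine Finset.sum_congr rfl fun e _ => ?_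
  simp [leftEntry_apply]
  ring

/-- The constant alternating form from which `E_{1,3}` is built. -/
def E13CLM : (Amb 1 × Amb 1) [⋀^Fin 3]→L[ℝ] ℝ :=
  (1 / (192 * Real.pi ^ 2)) • ∑ τ : Equiv.Perm (Fin 4), sgn τ •
    (cubicCLM (τ 0) (τ 1) (τ 2) (τ 3) + cubicCLM (τ 2) (τ 3) (τ 0) (τ 1))

theorem E13CLM_apply (w : Fin 3 → Amb 1 × Amb 1) :
    E13CLM w = kappa / 3 * (pairing (mat (w 0).1 0) ⁅mat (w 1).1 0, mat (w 2).1 0⁆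
      + pairing (mat (w 1).1 0) ⁅mat (w 2).1 0, mat (w 0).1 0⁆
      + pairing (mat (w 2).1 0) ⁅mat (w 0).1 0, mat (w 1).1 0⁆) := by
  have key : E13CLM w = (1 / (192 * Real.pi ^ 2)) *
      (pairing (mat (w 0).1 0) ⁅mat (w 1).1 0, mat (w 2).1 0⁆
        + pairing (mat (w 1).1 0) ⁅mat (w 2).1 0, mat (w 0).1 0⁆
        + pairing (mat (w 2).1 0) ⁅mat (w 0).1 0, mat (w 1).1 0⁆
        + (pairing ⁅mat (w 1).1 0, mat (w 2).1 0⁆ (mat (w 0).1 0)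
        + pairing ⁅mat (w 2).1 0, mat (w 0).1 0⁆ (mat (w 1).1 0)
        + pairing ⁅mat (w 0).1 0, mat (w 1).1 0⁆ (mat (w 2).1 0))) := by
    simp only [E13CLM, ContinuousAlternatingMap.smul_apply, ContinuousAlternatingMap.sum_apply,
      ContinuousAlternatingMap.add_apply, cubicCLM_apply, pairing_apply, smul_eq_mul,
      ← Finset.sum_add_distrib]
    congr 1
    refine Finset.sum_congr rfl fun τ _ => ?_
    ring
  rw [key, pairing_comm _ (mat (w 0).1 0), pairing_comm _ (mat (w 1).1 0),
    pairing_comm _ (mat (w 2).1 0), kappa]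
  ring

theorem wedge_eq_mcForm {p q : ℕ} {f : Fin q → Covector p} {l : Fin q → (Amb p × Amb p) →L[ℝ] ℝ}
    (hfl : ∀ i h (v : tangent h), f i h v = l i (mcCLM p (toAmb h) v)) :
    wedge f = mcForm (wedgeCLM l) := by
  funext h
  ext v
  rw [wedge_apply, mcForm_apply, wedgeCLM_apply]
  simp only [hfl]

theorem lmc_eq_leftEntry {p : ℕ} (i : Fin p) (a b : Fin 4) (h : N p) (v : tangent h) :
    lmc i a b h v = leftEntry i a b (mcCLM p (toAmb h) v) := by
  rw [lmc_apply, leftEntry_apply, mcCLM_toAmb_fst v.2]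

theorem rmc_eq_rightEntry {p : ℕ} (i : Fin p) (a b : Fin 4) (h : N p) (v : tangent h) :
    rmc i a b h v = rightEntry i a b (mcCLM p (toAmb h) v) := by
  rw [rmc_apply, rightEntry_apply, mcCLM_toAmb_snd v.2]

theorem E13_eq : E13 = mcForm E13CLM := by
  have h1 : ∀ a b c d, cubic a b c d = mcForm (cubicCLM a b c d) := by
    intro a b c d
    rw [cubic, cubicCLM, map_sum]
    refine Finset.sum_congr rfl fun e _ => wedge_eq_mcForm fun i h v => ?_
    fin_cases i <;> exact lmc_eq_leftEntry _ _ _ _ _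
  simp only [E13, E13CLM, map_smul, map_sum, map_add, h1]

/-- The constant alternating form from which `E_{2,2}` is built. -/
def E22CLM : (Amb 2 × Amb 2) [⋀^Fin 2]→L[ℝ] ℝ :=
  (-1 / (64 * Real.pi ^ 2)) • ∑ τ : Equiv.Perm (Fin 4), sgn τ •
    (wedgeCLM ![leftEntry 0 (τ 0) (τ 1), rightEntry 1 (τ 2) (τ 3)]
      + wedgeCLM ![leftEntry 0 (τ 2) (τ 3), rightEntry 1 (τ 0) (τ 1)])

theorem E22CLM_apply (w : Fin 2 → Amb 2 × Amb 2) :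
    E22CLM w = -kappa * (pairing (mat (w 0).1 0) (mat (w 1).2 1)
      - pairing (mat (w 1).1 0) (mat (w 0).2 1)) := by
  have key : E22CLM w = (-1 / (64 * Real.pi ^ 2)) *
      (pairing (mat (w 0).1 0) (mat (w 1).2 1) - pairing (mat (w 1).1 0) (mat (w 0).2 1)
        + (pairing (mat (w 1).2 1) (mat (w 0).1 0) - pairing (mat (w 0).2 1) (mat (w 1).1 0))) := by
    simp only [E22CLM, ContinuousAlternatingMap.smul_apply, ContinuousAlternatingMap.sum_apply,
      ContinuousAlternatingMap.add_apply, wedgeCLM_apply, Matrix.det_fin_two, pairing_apply,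
      smul_eq_mul, ← Finset.sum_add_distrib, ← Finset.sum_sub_distrib]
    congr 1
    refine Finset.sum_congr rfl fun τ _ => ?_
    simp [leftEntry_apply, rightEntry_apply]
    ring
  rw [key, pairing_comm (mat (w 1).2 1), pairing_comm (mat (w 0).2 1), kappa]
  ring

theorem E22_eq : E22 = mcForm E22CLM := by
  have h1 : ∀ a b c d, wedge ![lmc 0 a b, rmc 1 c d]
      = mcForm (wedgeCLM ![leftEntry (p := 2) 0 a b, rightEntry 1 c d]) := by
    refine fun a b c d => wedge_eq_mcForm fun i h v => ?_
    fin_cases i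
    · exact lmc_eq_leftEntry _ _ _ _ _
    · exact rmc_eq_rightEntry _ _ _ _ _
  simp only [E22, E22CLM, map_smul, map_sum, map_add, h1]

/-- The constant linear form from which `μ(X)` is built. -/
def muCLM (X : Mat) : (Amb 1 × Amb 1) [⋀^Fin 1]→L[ℝ] ℝ :=
  (-1 / (64 * Real.pi ^ 2)) • ∑ τ : Equiv.Perm (Fin 4), sgn τ •
      (X (τ 0) (τ 1) • wedgeCLM ![leftEntry 0 (τ 2) (τ 3)]
        + X (τ 2) (τ 3) • wedgeCLM ![leftEntry 0 (τ 0) (τ 1)])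
  - (1 / (64 * Real.pi ^ 2)) • ∑ τ : Equiv.Perm (Fin 4), sgn τ •
      (X (τ 0) (τ 1) • wedgeCLM ![rightEntry 0 (τ 2) (τ 3)]
        + X (τ 2) (τ 3) • wedgeCLM ![rightEntry 0 (τ 0) (τ 1)])

theorem muCLM_apply (X : Mat) (w : Fin 1 → Amb 1 × Amb 1) :
    muCLM X w = -kappa * (pairing X (mat (w 0).1 0) + pairing X (mat (w 0).2 0)) := by
  have key : muCLM X w = (-1 / (64 * Real.pi ^ 2)) *
        (pairing X (mat (w 0).1 0) + pairing (mat (w 0).1 0) X)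
      - (1 / (64 * Real.pi ^ 2)) *
        (pairing X (mat (w 0).2 0) + pairing (mat (w 0).2 0) X) := by
    simp only [muCLM, ContinuousAlternatingMap.smul_apply, ContinuousAlternatingMap.sum_apply,
      ContinuousAlternatingMap.add_apply, ContinuousAlternatingMap.sub_apply, wedgeCLM_apply,
      Matrix.det_fin_one, pairing_apply, smul_eq_mul, ← Finset.sum_add_distrib]
    congr 2
    all_goals
      refine Finset.sum_congr rfl fun τ _ => ?_
      simp [leftEntry_apply, rightEntry_apply]
      ring
  rw [key, pairing_comm (mat (w 0).1 0), pairing_comm (mat (w 0).2 0), kappa]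
  ring

theorem mu_eq (X : so4) : mu X = mcForm (muCLM X) := by
  have h1 : ∀ a b, wedge ![lmc 0 a b] = mcForm (wedgeCLM ![leftEntry (p := 1) 0 a b]) := by
    refine fun a b => wedge_eq_mcForm fun i h v => ?_
    fin_cases i
    exact lmc_eq_leftEntry _ _ _ _ _
  have h2 : ∀ a b, wedge ![rmc 0 a b] = mcForm (wedgeCLM ![rightEntry (p := 1) 0 a b]) := by
    refine fun a b => wedge_eq_mcForm fun i h v => ?_
    fin_cases i
    exact rmc_eq_rightEntry _ _ _ _ _
  simp only [mu, muCLM, map_smul, map_sum, map_add, map_sub, h1, h2]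

/-- `E_{1,3}` is a multiple of the Cartan `3`-form `⟨θ, [θ, θ]⟩`, where `θ = h⁻¹dh`: the three cyclic terms of
`E13CLM_apply` coincide on `𝔰𝔬(4)`. -/
theorem E13_apply (h : N 1) (v : Fin 3 → tangent h) :
    E13 h v = kappa * pairing (lmcMat h (v 0) 0) ⁅lmcMat h (v 1) 0, lmcMat h (v 2) 0⁆ := by
  have h1 := fun j => mcCLM_toAmb_fst (v j).2 0
  have h2 := fun j => lmcMat_mem (v j).2 0
  rw [E13_eq, mcForm_apply, E13CLM_apply, h1, h1, h1, pairing_lie_cyclic (h2 1) (lmcMat h (v 0) 0),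
    pairing_lie_cyclic (h2 0) (lmcMat h (v 2) 0)]
  ring

theorem E22_apply (h : N 2) (v : Fin 2 → tangent h) :
    E22 h v = -kappa * (pairing (lmcMat h (v 0) 0) (rmcMat h (v 1) 1)
      - pairing (lmcMat h (v 1) 0) (rmcMat h (v 0) 1)) := by
  rw [E22_eq, mcForm_apply, E22CLM_apply]
  simp only [mcCLM_toAmb_fst (v _).2, mcCLM_toAmb_snd (v _).2]

theorem mu_apply (X : so4) (h : N 1) (v : Fin 1 → tangent h) :
    mu X h v = -kappa * (pairing X (lmcMat h (v 0) 0) + pairing X (rmcMat h (v 0) 0)) := by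
  rw [mu_eq, mcForm_apply, muCLM_apply]
  simp only [mcCLM_toAmb_fst (v _).2, mcCLM_toAmb_snd (v _).2]

/-! ### Their exterior derivatives -/

theorem extd_mu_apply (X : so4) (h : N 1) (v : Fin 2 → tangent h) :
    extd (mu X) h v = kappa * (pairing X ⁅lmcMat h (v 0) 0, lmcMat h (v 1) 0⁆
      - pairing X ⁅rmcMat h (v 0) 0, rmcMat h (v 1) 0⁆) := by
  rw [mu_eq, extd_mcForm]
  have h1 := fun i j => mcCLM_tangent_fst (v i).2 (v j).2 0
  have h2 := fun i j => mcCLM_tangent_snd (v i).2 (v j).2 0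
  simp [Fin.sum_univ_succ, Fin.removeNth_apply, muCLM_apply, h1, h2]
  rw [← lie_skew (lmcMat h (v 1) 0), ← lie_skew (rmcMat h (v 1) 0), map_neg, map_neg]
  ring

theorem extd_E22_apply (h : N 2) (v : Fin 3 → tangent h) :
    extd E22 h v = kappa *
      (pairing (lmcMat h (v 0) 0) ⁅rmcMat h (v 1) 1, rmcMat h (v 2) 1⁆
        - pairing (lmcMat h (v 1) 0) ⁅rmcMat h (v 0) 1, rmcMat h (v 2) 1⁆
        + pairing (lmcMat h (v 2) 0) ⁅rmcMat h (v 0) 1, rmcMat h (v 1) 1⁆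
        + pairing ⁅lmcMat h (v 0) 0, lmcMat h (v 1) 0⁆ (rmcMat h (v 2) 1)
        - pairing ⁅lmcMat h (v 0) 0, lmcMat h (v 2) 0⁆ (rmcMat h (v 1) 1)
        + pairing ⁅lmcMat h (v 1) 0, lmcMat h (v 2) 0⁆ (rmcMat h (v 0) 1)) := by
  rw [E22_eq, extd_mcForm]
  have h1 := fun i j => mcCLM_tangent_fst (v i).2 (v j).2 0
  have h2 := fun i j => mcCLM_tangent_snd (v i).2 (v j).2 1
  have h3 := fun j => mcCLM_toAmb_fst (v j).2 0
  have h4 := fun j => mcCLM_toAmb_snd (v j).2 1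
  simp [Fin.sum_univ_succ, Fin.removeNth_apply, E22CLM_apply, h1, h2, h3, h4]
  rw [← lie_skew (lmcMat h (v 1) 0) (lmcMat h (v 0) 0),
    ← lie_skew (lmcMat h (v 2) 0) (lmcMat h (v 0) 0),
    ← lie_skew (lmcMat h (v 2) 0) (lmcMat h (v 1) 0),
    ← lie_skew (rmcMat h (v 1) 1) (rmcMat h (v 0) 1),
    ← lie_skew (rmcMat h (v 2) 1) (rmcMat h (v 0) 1),
    ← lie_skew (rmcMat h (v 2) 1) (rmcMat h (v 1) 1)]
  simp only [map_neg, LinearMap.neg_apply]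
  ring

/-- The Jacobi identity, paired with `D`. -/
theorem pairing_lie_lie_jacobi {A B : Mat} (hA : A ∈ so4) (hB : B ∈ so4) {C : Mat} (hC : C ∈ so4)
    (D : Mat) : pairing ⁅A, B⁆ ⁅C, D⁆ - pairing ⁅A, C⁆ ⁅B, D⁆ + pairing ⁅A, D⁆ ⁅B, C⁆ = 0 := by
  have jacobi : ⁅⁅A, B⁆, C⁆ - ⁅⁅A, C⁆, B⁆ + ⁅⁅B, C⁆, A⁆ = 0 := by
    simp only [Ring.lie_def]
    noncomm_ring
  rw [pairing_comm ⁅A, D⁆, pairing_lie_cyclic hC, pairing_lie_cyclic hB, pairing_lie_cyclic hA,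
    ← map_sub, ← map_add, jacobi, map_zero]

/-- The form `E_{1,3}` is closed. Each of the four terms of its exterior derivative vanishes by itself. -/
theorem extd_E13 : extd E13 = 0 := by
  funext h
  ext v
  rw [E13_eq, extd_mcForm]
  refine Finset.sum_eq_zero fun i _ => ?_
  have h1 := fun j => mcCLM_tangent_fst (v i).2 (v j).2 0
  have h3 := fun j => mcCLM_toAmb_fst (v j).2 0
  have hA : ∀ j, lmcMat h (v j) 0 ∈ so4 := fun j => lmcMat_mem (v j).2 0
  simp [-lie_lie, Fin.sum_univ_three, Fin.removeNth_apply, E13CLM_apply, h1, h3]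
  generalize hA₀ : lmcMat h (v i) 0 = A
  generalize hB₀ : lmcMat h (v (i.succAbove 0)) 0 = B
  generalize hC₀ : lmcMat h (v (i.succAbove 1)) 0 = C
  generalize hD₀ : lmcMat h (v (i.succAbove 2)) 0 = D
  have hA : A ∈ so4 := hA₀ ▸ hA _
  have hB : B ∈ so4 := hB₀ ▸ lmcMat_mem (v _).2 0
  have hC : C ∈ so4 := hC₀ ▸ lmcMat_mem (v _).2 0
  have hD : D ∈ so4 := hD₀ ▸ lmcMat_mem (v _).2 0
  rw [pairing_lie_cyclic (so4.lie_mem hA hB) D C, pairing_lie_cyclic hD C,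
    pairing_lie_cyclic (so4.lie_mem hA hC) B D, pairing_lie_cyclic hB D,
    pairing_lie_cyclic (so4.lie_mem hA hD) C B, pairing_lie_cyclic hC B,
    ← lie_skew D B, map_neg]
  linear_combination (-kappa / 2) * pairing_lie_lie_jacobi hA hB hC D

/-! ### Faces, conjugation and contraction -/

theorem coe_mul_inv (g k : SO4) : ((g * k : SO4) : Mat)⁻¹ = (k : Mat)⁻¹ * (g : Mat)⁻¹ := by
  rw [Submonoid.coe_mul, Matrix.mul_inv_rev]

theorem lmcMat_face {p : ℕ} (i : Fin (p + 2)) (h : N (p + 1)) (v : Amb (p + 1)) (j : Fin p) :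
    lmcMat (face i h) (dfaceAmb i h v) j = if (j : ℕ) + 1 < i then lmcMat h v j.castSucc
      else if (j : ℕ) + 1 = i then
        (h j.succ : Mat)⁻¹ * lmcMat h v j.castSucc * (h j.succ : Mat) + lmcMat h v j.succ
      else lmcMat h v j.succ := by
  rw [lmcMat, mat_dfaceAmb]
  simp only [face]
  split_ifs
  · rfl
  · rw [coe_mul_inv, mul_add, lmcMat, lmcMat]
    congr 1
    · simp only [Matrix.mul_assoc]
    · rw [Matrix.mul_assoc, ← Matrix.mul_assoc (h j.castSucc : Mat)⁻¹, inv_mul_self, Matrix.one_mul]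
  · rfl

theorem rmcMat_face {p : ℕ} (i : Fin (p + 2)) (h : N (p + 1)) (v : Amb (p + 1)) (j : Fin p) :
    rmcMat (face i h) (dfaceAmb i h v) j = if (j : ℕ) + 1 < i then rmcMat h v j.castSucc
      else if (j : ℕ) + 1 = i then
        rmcMat h v j.castSucc + (h j.castSucc : Mat) * rmcMat h v j.succ * (h j.castSucc : Mat)⁻¹
      else rmcMat h v j.succ := by
  rw [rmcMat, mat_dfaceAmb]
  simp only [face]
  split_ifs
  · rfl
  · rw [coe_mul_inv, add_mul, rmcMat, rmcMat]
    congr 1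
    · rw [Matrix.mul_assoc, ← Matrix.mul_assoc (h j.succ : Mat), mul_inv_self, Matrix.one_mul]
    · simp only [Matrix.mul_assoc]
  · rfl

theorem lmcMat_conj {p : ℕ} (g : SO4) (h : N p) (v : Amb p) (i : Fin p) :
    lmcMat (conj g h) (dconjAmb p g v) i = (g : Mat) * lmcMat h v i * (g : Mat)⁻¹ := by
  rw [lmcMat, lmcMat, mat_dconjAmb, conj, coe_mul_inv, coe_mul_inv, coe_inv_SO4]
  simp only [Matrix.mul_assoc]
  rw [← Matrix.mul_assoc (g : Mat)⁻¹ (g : Mat), inv_mul_self, Matrix.one_mul, ← coe_inv_SO4 g,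
    ← coe_inv_SO4 g⁻¹, inv_inv]

theorem rmcMat_conj {p : ℕ} (g : SO4) (h : N p) (v : Amb p) (i : Fin p) :
    rmcMat (conj g h) (dconjAmb p g v) i = (g : Mat) * rmcMat h v i * (g : Mat)⁻¹ := by
  rw [rmcMat, rmcMat, mat_dconjAmb, conj, coe_mul_inv, coe_mul_inv, coe_inv_SO4]
  simp only [Matrix.mul_assoc]
  rw [← coe_inv_SO4 g, ← coe_inv_SO4 g⁻¹, inv_inv, coe_inv_SO4,
    ← Matrix.mul_assoc (g : Mat)⁻¹ (g : Mat), inv_mul_self, Matrix.one_mul]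

theorem lie_conj (g : SO4) (A B : Mat) :
    ⁅(g : Mat) * A * (g : Mat)⁻¹, (g : Mat) * B * (g : Mat)⁻¹⁆
      = (g : Mat) * ⁅A, B⁆ * (g : Mat)⁻¹ := by
  have key : ∀ A B : Mat, ((g : Mat) * A * (g : Mat)⁻¹) * ((g : Mat) * B * (g : Mat)⁻¹)
      = (g : Mat) * (A * B) * (g : Mat)⁻¹ := by
    intro A B
    simp only [Matrix.mul_assoc]
    rw [← Matrix.mul_assoc (g : Mat)⁻¹ (g : Mat), inv_mul_self, Matrix.one_mul]
  rw [Ring.lie_def, Ring.lie_def, key, key, mul_sub, sub_mul]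

theorem lmcMat_fundVec {p : ℕ} (X : so4) (h : N p) (i : Fin p) :
    lmcMat h (fundVec X h) i = (X : Mat) - (h i : Mat)⁻¹ * (X : Mat) * (h i : Mat) := by
  show (h i : Mat)⁻¹ * ((h i : Mat) * (X : Mat) - (X : Mat) * (h i : Mat)) = _
  rw [mul_sub, ← Matrix.mul_assoc, inv_mul_self, Matrix.one_mul, Matrix.mul_assoc]

theorem rmcMat_fundVec {p : ℕ} (X : so4) (h : N p) (i : Fin p) :
    rmcMat h (fundVec X h) i = (h i : Mat) * (X : Mat) * (h i : Mat)⁻¹ - (X : Mat) := by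
  show ((h i : Mat) * (X : Mat) - (X : Mat) * (h i : Mat)) * (h i : Mat)⁻¹ = _
  rw [sub_mul, Matrix.mul_assoc (X : Mat), mul_inv_self, Matrix.mul_one]

theorem facePull_apply {p q : ℕ} (i : Fin (p + 2)) (α : Form p q) (h : N (p + 1))
    (v : Fin q → tangent h) : facePull q i α h v =
      α (face i h) fun j => ⟨dfaceAmb i h (v j), dfaceAmb_mem i h _ (v j).2⟩ := rfl

theorem conjPull_apply {p q : ℕ} (g : SO4) (α : Form p q) (h : N p)
    (v : Fin q → tangent h) : conjPull p q g α h v =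
      α (conj g h) fun j => ⟨dconjAmb p g (v j), dconjAmb_mem g h _ (v j).2⟩ := rfl

theorem contract_apply {p q : ℕ} (X : so4) (α : Form p (q + 1)) (h : N p)
    (v : Fin q → tangent h) : contract X α h v = α h (Matrix.vecCons (fundVec X h) v) := rfl

theorem dSimp_apply {p q : ℕ} (α : Form p q) (h : N (p + 1)) (v : Fin q → tangent h) :
    dSimp α h v = ∑ i : Fin (p + 2), (-1 : ℝ) ^ (i : ℕ) * facePull q i α h v := by
  rw [dSimp, Finset.sum_apply]
  exact map_sum (⟨⟨fun η => η v, rfl⟩, fun _ _ => rfl⟩ : (tangent h) [⋀^Fin q]→ₗ[ℝ] ℝ →+ ℝ) _ _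

/-! ### The identities between the components -/

theorem conjPull_E13 (g : SO4) : conjPull 1 3 g E13 = E13 := by
  funext h
  ext v
  rw [conjPull_apply, E13_apply, E13_apply]
  simp only [lmcMat_conj, lie_conj, pairing_conj_SO4]

theorem conjPull_E22 (g : SO4) : conjPull 2 2 g E22 = E22 := by
  funext h
  ext v
  rw [conjPull_apply, E22_apply, E22_apply]
  simp only [lmcMat_conj, rmcMat_conj, pairing_conj_SO4]

theorem conjPull_mu (g : SO4) (X : so4) : conjPull 1 1 g (mu (Ad g X)) = mu X := by
  funext h
  ext v
  rw [conjPull_apply, mu_apply, mu_apply]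
  simp only [lmcMat_conj, rmcMat_conj, Ad, pairing_conj_SO4]

/-- The contractions of the two halves of `μ(X)` cancel: `⟨X, X - h⁻¹Xh⟩ + ⟨X, hXh⁻¹ - X⟩ = 0` by invariance. -/
theorem contract_mu (X : so4) : contract X (mu X) = 0 := by
  funext h
  ext v
  rw [contract_apply, mu_apply]
  simp only [Matrix.cons_val_zero, lmcMat_fundVec, rmcMat_fundVec, map_sub]
  rw [pairing_conj_right, pairing_comm (X : Mat) (_ * _ * _)]
  simp

theorem extd_mu (X : so4) : extd (mu X) = contract X E13 := by
  funext h
  ext v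
  rw [contract_apply, extd_mu_apply, E13_apply]
  simp only [Matrix.cons_val_zero, Matrix.cons_val_one, Matrix.cons_val_two,
    lmcMat_fundVec, rmcMat_eq, map_sub, LinearMap.sub_apply, lie_conj]
  rw [pairing_conj_right]
  rfl

theorem dSimp_mu (X : so4) : dSimp (mu X) = contract X E22 := by
  funext h
  ext v
  rw [contract_apply, dSimp_apply, E22_apply]
  simp only [facePull_apply, mu_apply, lmcMat_face, rmcMat_face]
  simp [lmcMat_fundVec, rmcMat_fundVec, Fin.sum_univ_succ]
  rw [pairing_conj_right (h 0), pairing_conj_right (h 1), pairing_comm _ (lmcMat h (v 0) 0),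
    pairing_comm (X : Mat) (_ * _ * _)]
  ring

theorem dSimp_E22 : dSimp E22 = 0 := by
  funext h
  ext v
  rw [dSimp_apply]
  simp only [facePull_apply, E22_apply, lmcMat_face, rmcMat_face]
  simp [Fin.sum_univ_succ, pairing_conj_right]
  ring

/-- The terms of `⟨θ, [θ, θ]⟩` on a product `h₁h₂` that mix the two factors are the exterior derivative of
`E_{2,2}`. -/
theorem dSimp_E13_add_extd_E22 : dSimp E13 + extd E22 = 0 := by
  funext h
  ext v
  show dSimp E13 h v + extd E22 h v = 0
  -- `A j` stands for `h₂⁻¹ θ₁ h₂`. In terms of `A` and the values of `θ₂`, all conjugations disappear.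
  have hA : ∀ j, ∃ A ∈ so4, lmcMat h (v j) 0 = (h 1 : Mat) * A * (h 1 : Mat)⁻¹ ∧
      (h 1 : Mat)⁻¹ * lmcMat h (v j) 0 * (h 1 : Mat) = A := fun j =>
    ⟨_, inv_mul_mul_mem (h 1) (lmcMat_mem (v j).2 0), by
      simp only [Matrix.mul_assoc, mul_inv_self, Matrix.mul_one]
      rw [← Matrix.mul_assoc, mul_inv_self, Matrix.one_mul], rfl⟩
  choose A hA hθ hAθ using hA
  have hB : ∀ j, lmcMat h (v j) 1 ∈ so4 := fun j => lmcMat_mem (v j).2 1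
  rw [dSimp_apply, extd_E22_apply]
  simp only [facePull_apply, E13_apply, lmcMat_face]
  simp [-lie_lie, Fin.sum_univ_succ, hAθ]
  simp only [rmcMat_eq, lie_conj, hθ, pairing_conj_SO4]
  rw [pairing_comm (lmcMat h (v 0) 1) ⁅A 1, A 2⁆, pairing_lie_cyclic (hA 1) (A 0) (A 2),
    pairing_lie_cyclic (hA 1) (A 0) (lmcMat h (v 2) 1), pairing_comm (lmcMat h (v 2) 1) ⁅A 0, A 1⁆,
    pairing_comm (A 2) ⁅A 0, A 1⁆, pairing_lie_cyclic (hB 1) (A 0) (A 2),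
    pairing_lie_cyclic (hA 0) (A 2) (lmcMat h (v 1) 1), pairing_comm _ ⁅A 2, A 0⁆,
    pairing_lie_cyclic (hB 1) (lmcMat h (v 0) 1) (A 2),
    pairing_lie_cyclic (hA 1) (lmcMat h (v 0) 1) (lmcMat h (v 2) 1),
    pairing_lie_cyclic (hB 0) (lmcMat h (v 2) 1) (A 1),
    ← lie_skew (A 2) (A 0), ← lie_skew (lmcMat h (v 2) 1) (lmcMat h (v 0) 1)]
  simp only [map_neg, LinearMap.neg_apply]
  ring

/-! ### The total complex -/

/-- The exterior derivative is defined by a choice of an extension, so that this is not true by definition. -/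
theorem extd_zero (p q : ℕ) : extd (0 : Form p q) = 0 := by
  rw [← map_zero (mcForm (p := p) (q := q))]
  funext h
  ext v
  rw [extd_mcForm]
  simp

theorem dSimp_zero (p q : ℕ) : dSimp (0 : Form p q) = 0 := by
  simp [dSimp]

theorem contract_zero {p q : ℕ} (X : so4) : contract X (0 : Form p (q + 1)) = 0 := by
  rfl

theorem const_mem_PolyForm {p q : ℕ} {ω : Form p q} (hω : ω ∈ Omega p q) :
    (fun _ => ω) ∈ PolyForm p q 0 :=
  Submodule.subset_span ⟨Fin.elim0, ω, hω, by simp⟩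

/-- A linear function is a sum over a basis of coordinates times constant forms. -/
theorem linear_mem_PolyForm {p q : ℕ} (f : so4 →ₗ[ℝ] Form p q) (hf : ∀ X, f X ∈ Omega p q) :
    (fun X => f X) ∈ PolyForm p q 1 := by
  let b := Module.finBasis ℝ so4
  have h1 : (fun X => f X) = ∑ i, fun X => (∏ _j : Fin 1, b.coord i X) • f (b i) := by
    funext X
    have h2 := congrArg f (b.sum_repr X)
    simp only [map_sum, map_smul] at h2
    simpa [Finset.sum_apply] using h2.symm
  rw [h1]
  exact Submodule.sum_mem _ fun i _ =>
    Submodule.subset_span ⟨fun _ => b.coord i, f (b i), hf _, rfl⟩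

theorem E13_mem : (fun _ => E13) ∈ EquivForm 1 3 0 :=
  ⟨const_mem_PolyForm (E13_eq ▸ mcForm_mem _), fun g _ => conjPull_E13 g⟩

theorem E22_mem : (fun _ => E22) ∈ EquivForm 2 2 0 :=
  ⟨const_mem_PolyForm (E22_eq ▸ mcForm_mem _), fun g _ => conjPull_E22 g⟩

theorem mu_mem : mu ∈ EquivForm 1 1 1 := by
  refine ⟨?_, conjPull_mu⟩
  let f : so4 →ₗ[ℝ] Form 1 1 :=
    { toFun := mu
      map_add' := fun X Y => by
        funext h
        ext v
        show mu (X + Y) h v = mu X h v + mu Y h v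
        have hXY : ((X + Y : so4) : Mat) = X + Y := rfl
        simp only [mu_apply, hXY, map_add, LinearMap.add_apply]
        ring
      map_smul' := fun c X => by
        funext h
        ext v
        show mu (c • X) h v = c * mu X h v
        have hcX : ((c • X : so4) : Mat) = c • (X : Mat) := rfl
        simp only [mu_apply, hcX, map_smul, LinearMap.smul_apply, smul_eq_mul]
        ring }
  exact linear_mem_PolyForm f fun X => by
    show mu X ∈ _
    rw [mu_eq]
    exact mcForm_mem _

theorem single_same (p q r : ℕ) (α : so4 → Form p q) : single p q r α p q r = α := by
  simp [single]

theorem single_of_ne {p q r p' q' r' : ℕ} (α : so4 → Form p q) (hne : (p', q', r') ≠ (p, q, r)) :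
    single p q r α p' q' r' = 0 := by
  rcases eq_or_ne p' p with rfl | hp
  · rcases eq_or_ne q' q with rfl | hq
    · have hr : r' ≠ r := fun hr => hne (by rw [hr])
      simp [single, hr]
    · simp [single, hq]
  · simp [single, hp]

theorem single_mem_Cochain {p q r n : ℕ} {α : so4 → Form p q} (hα : α ∈ EquivForm p q r)
    (hn : p + q + 2 * r = n) : single p q r α ∈ Cochain n := by
  intro p' q' r'
  by_cases h : (p', q', r') = (p, q, r)
  · obtain ⟨rfl, rfl, rfl⟩ : p' = p ∧ q' = q ∧ r' = r := by simpa using h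
    rw [single_same]
    exact ⟨hα, fun h => absurd hn h⟩
  · rw [single_of_ne α h]
    exact ⟨zero_mem _, fun _ => rfl⟩

/-- The total cochain `E_{1,3} + E_{2,2} + μ`. -/
def cocycle : Family :=
  single 1 3 0 (fun _ => E13) + single 2 2 0 (fun _ => E22) + single 1 1 1 mu

theorem cocycle_130 (X : so4) : cocycle 1 3 0 X = E13 := by
  simp [cocycle, single_same, single_of_ne]

theorem cocycle_220 (X : so4) : cocycle 2 2 0 X = E22 := by
  simp [cocycle, single_same, single_of_ne]

theorem cocycle_111 (X : so4) : cocycle 1 1 1 X = mu X := by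
  simp [cocycle, single_same, single_of_ne]

theorem cocycle_eq_zero {p q r : ℕ} (h1 : (p, q, r) ≠ (1, 3, 0)) (h2 : (p, q, r) ≠ (2, 2, 0))
    (h3 : (p, q, r) ≠ (1, 1, 1)) : cocycle p q r = 0 := by
  simp only [cocycle, Pi.add_apply, single_of_ne _ h1, single_of_ne _ h2, single_of_ne _ h3,
    add_zero]

theorem partSimp_succ (c : Family) (p q r : ℕ) (X : so4) :
    partSimp c (p + 1) q r X = dSimp (c p q r X) := rfl

theorem partExt_succ (c : Family) (p q r : ℕ) (X : so4) :
    partExt c p (q + 1) r X = extd (c p q r X) := rfl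

theorem partContract_succ (c : Family) (p q r : ℕ) (X : so4) :
    partContract c p q (r + 1) X = contract X (c p (q + 1) r X) := rfl

theorem partSimp_cocycle_eq_zero {p q r : ℕ} (X : so4) (h1 : (p, q, r) ≠ (2, 3, 0))
    (h2 : (p, q, r) ≠ (3, 2, 0)) (h3 : (p, q, r) ≠ (2, 1, 1)) : partSimp cocycle p q r X = 0 := by
  rcases p with _ | p
  · rfl
  · rw [partSimp_succ, cocycle_eq_zero (by simpa using h1) (by simpa using h2) (by simpa using h3),
      Pi.zero_apply, dSimp_zero]

theorem partExt_cocycle_eq_zero {p q r : ℕ} (X : so4) (h1 : (p, q, r) ≠ (1, 4, 0))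
    (h2 : (p, q, r) ≠ (2, 3, 0)) (h3 : (p, q, r) ≠ (1, 2, 1)) : partExt cocycle p q r X = 0 := by
  rcases q with _ | q
  · rfl
  · rw [partExt_succ, cocycle_eq_zero (by simpa using h1) (by simpa using h2) (by simpa using h3),
      Pi.zero_apply, extd_zero]

theorem partContract_cocycle_eq_zero {p q r : ℕ} (X : so4) (h1 : (p, q, r) ≠ (1, 2, 1))
    (h2 : (p, q, r) ≠ (2, 1, 1)) (h3 : (p, q, r) ≠ (1, 0, 2)) :
    partContract cocycle p q r X = 0 := by
  rcases r with _ | r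
  · rfl
  · rw [partContract_succ, cocycle_eq_zero (by simpa using h1) (by simpa using h2) (by simpa using h3),
      Pi.zero_apply, contract_zero]

theorem totalD_cocycle : totalD cocycle = 0 := by
  funext p q r X
  show partSimp cocycle p q r X + (-1 : ℝ) ^ p • (partExt cocycle p q r X
    - partContract cocycle p q r X) = 0
  by_cases h140 : (p, q, r) = (1, 4, 0)
  · obtain ⟨rfl, rfl, rfl⟩ : p = 1 ∧ q = 4 ∧ r = 0 := by simpa using h140
    rw [partSimp_cocycle_eq_zero X (by simp) (by simp) (by simp),
      partContract_cocycle_eq_zero X (by simp) (by simp) (by simp), partExt_succ, cocycle_130, extd_E13]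
    simp
  by_cases h121 : (p, q, r) = (1, 2, 1)
  · obtain ⟨rfl, rfl, rfl⟩ : p = 1 ∧ q = 2 ∧ r = 1 := by simpa using h121
    rw [partSimp_cocycle_eq_zero X (by simp) (by simp) (by simp), partExt_succ, partContract_succ,
      cocycle_111, cocycle_130, extd_mu]
    simp
  by_cases h102 : (p, q, r) = (1, 0, 2)
  · obtain ⟨rfl, rfl, rfl⟩ : p = 1 ∧ q = 0 ∧ r = 2 := by simpa using h102
    rw [partSimp_cocycle_eq_zero X (by simp) (by simp) (by simp),
      partExt_cocycle_eq_zero X (by simp) (by simp) (by simp), partContract_succ, cocycle_111,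
      contract_mu]
    simp
  by_cases h230 : (p, q, r) = (2, 3, 0)
  · obtain ⟨rfl, rfl, rfl⟩ : p = 2 ∧ q = 3 ∧ r = 0 := by simpa using h230
    rw [partContract_cocycle_eq_zero X (by simp) (by simp) (by simp), partSimp_succ, partExt_succ,
      cocycle_130, cocycle_220, sub_zero, neg_one_sq, one_smul, dSimp_E13_add_extd_E22]
  by_cases h211 : (p, q, r) = (2, 1, 1)
  · obtain ⟨rfl, rfl, rfl⟩ : p = 2 ∧ q = 1 ∧ r = 1 := by simpa using h211
    rw [partExt_cocycle_eq_zero X (by simp) (by simp) (by simp), partSimp_succ, partContract_succ,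
      cocycle_111, cocycle_220, dSimp_mu]
    simp
  by_cases h320 : (p, q, r) = (3, 2, 0)
  · obtain ⟨rfl, rfl, rfl⟩ : p = 3 ∧ q = 2 ∧ r = 0 := by simpa using h320
    rw [partExt_cocycle_eq_zero X (by simp) (by simp) (by simp),
      partContract_cocycle_eq_zero X (by simp) (by simp) (by simp), partSimp_succ, cocycle_220,
      dSimp_E22]
    simp
  rw [partSimp_cocycle_eq_zero X h230 h320 h211, partExt_cocycle_eq_zero X h140 h230 h121,
    partContract_cocycle_eq_zero X h121 h211 h102]
  simp

end EquivariantSimplicial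

end

theorem theorem4p10 :
    EquivariantSimplicial.IsCocycle 4
      (EquivariantSimplicial.single 1 3 0 (fun _ => EquivariantSimplicial.E13)
        + EquivariantSimplicial.single 2 2 0 (fun _ => EquivariantSimplicial.E22)
        + EquivariantSimplicial.single 1 1 1 EquivariantSimplicial.mu) :=
  ⟨add_mem (add_mem (EquivariantSimplicial.single_mem_Cochain EquivariantSimplicial.E13_mem rfl)
    (EquivariantSimplicial.single_mem_Cochain EquivariantSimplicial.E22_mem rfl))
    (EquivariantSimplicial.single_mem_Cochain EquivariantSimplicial.mu_mem rfl),
    EquivariantSimplicial.totalD_cocycle⟩
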